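/- Let $G=(V,E)$ be a finite undirected graph (loops and parallel edges are allowed), let $h,k$ be positive integers and let $\ell(1),\dots,\ell(k)$ be positive integers. An $h$-regular packing of $k$ forests in $G$ is a family $F_1,\dots,F_k$ of pairwise edge-disjoint subgraphs of $G$ (not necessarily spanning, isolated vertices allowed), each of which is a forest (i.e. contains no cycle), such that every vertex of $G$ belongs to exactly $h$ of the forests. For a partition $\mathcal P$ of $V$ (into non-empty sets), let $e_E(\mathcal P)$ be the number of edges of $G$ that have exactly one end in some member of $\mathcal P$, that is, whose ends lie in two different members of $\mathcal P$. Then there exists an $h$-regular packing $F_1,\dots,F_k$ of $k$ forests in $G$ such that $F_i$ has exactly $\ell(i)$ connected components for every $i=1,\dots,k$ if and only if the following three conditions hold: \begin{enumerate} \item $|V|\ge \ell(i)$ for every $1\le i\le k$; \item $h|V|\ge \sum_{i=1}^k \ell(i)$; \item $\sum_{i=1}^k \min\{\ell(i),|\mathcal P|\}+e_E(\mathcal P)\ge h|\mathcal P|$ for every partition $\mathcal P$ of $V$. \end{enumerate} -/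

import Mathlib

/-! Undirected graphs are multigraphs (Mathlib's `Graph α β`, with vertex set `G.vertexSet`,
edge set `G.edgeSet`; loops and parallel edges are allowed). A subgraph of `G` is some `H ≤ G`. -/

namespace ForestPacking

variable {α β : Type*}

/-- A cycle of length `n + 1` in `G`: pairwise distinct vertices `v 0, …, v n` and pairwise
distinct edges `e 0, …, e n`, where `e i` joins `v i` and `v (i + 1)`, indices being cyclic.
For `n = 0` this is a loop, for `n = 1` a pair of parallel edges. -/
def IsCycle (G : Graph α β) (n : ℕ) (v : Fin (n + 1) → α) (e : Fin (n + 1) → β) : Prop :=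
  Function.Injective v ∧ Function.Injective e ∧ ∀ i, G.IsLink (e i) (v i) (v (i + 1))

/-- A forest is a graph that has no cycle. -/
def IsForest (G : Graph α β) : Prop :=
  ∀ (n : ℕ) (v : Fin (n + 1) → α) (e : Fin (n + 1) → β), ¬ IsCycle G n v e

/-- The vertices that can be reached from `x` along edges of `G`. -/
def reachableSet (G : Graph α β) (x : α) : Set α :=
  {y | Relation.ReflTransGen G.Adj x y}

/-- The vertex sets of the connected components of `G`. -/
def components (G : Graph α β) : Set (Set α) :=
  {C | ∃ x ∈ G.vertexSet, C = reachableSet G x}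

/-- The number of connected components of `G`. -/
noncomputable def numComponents (G : Graph α β) : ℕ :=
  (components G).ncard

/-- The edge `e` of `G` enters `X`: it has one end in `X` and the other one outside of `X`. -/
def Enters (G : Graph α β) (e : β) (X : Set α) : Prop :=
  ∃ x y, G.IsLink e x y ∧ x ∈ X ∧ y ∉ X

/-- The number of edges of `G` that enter some member of the partition `P` of the vertex set. -/
noncomputable def crossingNumber (G : Graph α β) (P : Finpartition G.vertexSet) : ℕ :=
  {e ∈ G.edgeSet | ∃ X ∈ P.parts, Enters G e X}.ncard

/-- `F 0, …, F (k - 1)` is an `h`-regular packing of forests in `G`: the `F i` are pairwise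
edge-disjoint subgraphs of `G`, each a forest (not necessarily spanning), and every vertex of `G`
belongs to exactly `h` of them. -/
structure IsRegularForestPacking (G : Graph α β) (h k : ℕ) (F : Fin k → Graph α β) : Prop where
  le : ∀ i, F i ≤ G
  isForest : ∀ i, IsForest (F i)
  edgeDisjoint : ∀ i j, i ≠ j → Disjoint (F i).edgeSet (F j).edgeSet
  regular : ∀ v ∈ G.vertexSet, {i : Fin k | v ∈ (F i).vertexSet}.ncard = h

end ForestPacking

/-!
Necessity is a double count. Label every vertex by its part of `𝒫`. A forest is joined together by
its edges, so the labels met by `F i` number at most its components plus its edges between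
different parts; on the other hand every part is met by at least `h` of the forests.

For sufficiency, regard the forests as colours and grow them from root vertices. If `C v` is the set
of colours rooted at `v`, the partition condition says that for `C = ∅` the colours that can still
be placed make up for the missing edges. Partitions that forbid an additional root can be uncrossed,
so the roots can be placed one at a time until the condition holds without any further root: the
number of edges that cross a family of disjoint sets `X` is then at least the sum of their demands
`h - |⋃ v ∈ X, C v|`. By a Frank-type orientation theorem for intersecting supermodular demands, the
edges can be oriented such that every `X` is entered by as many arcs as it demands. As in Lovász's
proof of Edmonds' branching theorem, some colour can always be passed on along an arc into a vertex
with fewer than `h` colours without destroying this property of the remaining arcs. Each such step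
adds a leaf to a forest, so the number of its components remains the number of its roots.
-/

namespace ForestPacking

open Finset

section Uncrossing

variable {W : Type*} [DecidableEq W] {A B C : Finset W}

/-- Supermodularity of a set function on pairs of intersecting sets. -/
def IntersectingSupermodular (p : Finset W → ℤ) : Prop :=
  ∀ X Y : Finset W, (X ∩ Y).Nonempty → p X + p Y ≤ p (X ∪ Y) + p (X ∩ Y)

theorem intersectingSupermodular_const (c : ℤ) :
    IntersectingSupermodular fun _ : Finset W => c :=
  fun _ _ _ => le_rfl

theorem IntersectingSupermodular.add_sum_le {p : Finset W → ℤ} (hp : IntersectingSupermodular p)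
    (Y : Finset W) {S : Finset (Finset W)} (hS : (S : Set (Finset W)).PairwiseDisjoint id)
    (hY : ∀ X ∈ S, (X ∩ Y).Nonempty) :
    p Y + ∑ X ∈ S, p X ≤ p (Y ∪ S.sup id) + ∑ X ∈ S, p (X ∩ Y) := by
  induction S using Finset.induction_on with
  | empty => simp
  | insert X S hX ih =>
    simp only [coe_insert, Set.pairwiseDisjoint_insert, mem_coe, id] at hS
    simp only [mem_insert, forall_eq_or_imp] at hY
    have hdisj : Disjoint X (S.sup id) :=
      Finset.disjoint_sup_right.2 fun Z hZ => hS.2 Z hZ fun h => hX (h ▸ hZ)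
    have hinter : X ∩ (Y ∪ S.sup id) = X ∩ Y := by
      rw [inter_union_distrib_left, disjoint_iff_inter_eq_empty.1 hdisj, union_empty]
    have hpair := hp X (Y ∪ S.sup id) (hinter ▸ hY.1)
    rw [hinter, union_left_comm] at hpair
    have := ih hS.1 hY.2
    rw [sum_insert hX, sum_insert hX, sup_insert, id, sup_eq_union]
    linarith

/-- The union of a partition of `A` and a partition of `B`, for disjoint `A` and `B`. -/
def disjUnion (P : Finpartition A) (Q : Finpartition B) (hAB : Disjoint A B) (hC : A ∪ B = C) :
    Finpartition C where
  parts := P.parts ∪ Q.parts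
  supIndep := by
    rw [supIndep_iff_pairwiseDisjoint, coe_union, Set.pairwiseDisjoint_union]
    exact ⟨P.disjoint, Q.disjoint, fun X hX Y hY _ => hAB.mono (P.le hX) (Q.le hY)⟩
  sup_parts := by rw [sup_union, P.sup_parts, Q.sup_parts, ← hC, sup_eq_union]
  bot_notMem := fun h => (mem_union.1 h).elim P.bot_notMem Q.bot_notMem

theorem sum_disjUnion {M : Type*} [AddCommMonoid M] (P : Finpartition A) (Q : Finpartition B)
    (hAB : Disjoint A B) (hC : A ∪ B = C) (f : Finset W → M) :
    ∑ X ∈ (disjUnion P Q hAB hC).parts, f X = ∑ X ∈ P.parts, f X + ∑ X ∈ Q.parts, f X := by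
  refine sum_union (disjoint_left.2 fun X hP hQ => ?_)
  obtain ⟨w, hw⟩ := P.nonempty_of_mem_parts hP
  exact disjoint_left.1 hAB (P.subset hP hw) (Q.subset hQ hw)

theorem sum_restrict_parts {M : Type*} [AddCommMonoid M] (P : Finpartition A) (hB : B ⊆ A)
    (f : Finset W → M) :
    ∑ X ∈ (P.restrict hB).parts, f X = ∑ X ∈ P.parts with (X ∩ B).Nonempty, f (X ∩ B) := by
  have hsum := P.sum_restrict hB (fun X => if X.Nonempty then f X else 0) (by simp)
  exact (sum_congr rfl fun X hX => (if_pos (Finpartition.nonempty_of_mem_parts _ hX)).symm).trans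
    (hsum.trans (sum_filter _ _).symm)

theorem parts_avoid_of_mem (Q : Finpartition B) {Y : Finset W} (hY : Y ∈ Q.parts) :
    (Q.avoid Y).parts = Q.parts.erase Y := by
  ext X
  rw [Finpartition.mem_avoid, mem_erase]
  constructor
  · rintro ⟨Z, hZ, hZY, rfl⟩
    have hne : Z ≠ Y := by rintro rfl; exact hZY le_rfl
    have hdisj : Disjoint Z Y := Q.disjoint hZ hY hne
    exact (sdiff_eq_self_of_disjoint hdisj).symm ▸ ⟨hne, hZ⟩
  · rintro ⟨hne, hX⟩
    have hdisj : Disjoint X Y := Q.disjoint hX hY hne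
    exact ⟨X, hX, fun h => Q.ne_bot hX (disjoint_self.1 (hdisj.mono_right h)),
      sdiff_eq_self_of_disjoint hdisj⟩

/-- The partition of `A ∪ Y` that arises from a partition of `A` by replacing the parts that meet
`Y` by their union with `Y`. -/
def absorb (P : Finpartition A) {Y : Finset W} (hY : Y.Nonempty) : Finpartition (A ∪ Y) :=
  disjUnion (P.ofSubset (filter_subset (fun X => ¬ (X ∩ Y).Nonempty) P.parts) rfl)
    (Finpartition.indiscrete (a := Y ∪ sup {X ∈ P.parts | (X ∩ Y).Nonempty} id)
      (hY.mono subset_union_left).ne_empty)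
    (disjoint_union_right.2
      ⟨Finset.disjoint_sup_left.2 fun X hX =>
        disjoint_iff_inter_eq_empty.2 (not_nonempty_iff_eq_empty.1 (mem_filter.1 hX).2),
      Finset.disjoint_sup_left.2 fun X hX => Finset.disjoint_sup_right.2 fun Z hZ =>
        P.disjoint (mem_filter.1 hX).1 (mem_filter.1 hZ).1
          fun h => (mem_filter.1 hX).2 (h ▸ (mem_filter.1 hZ).2)⟩)
    (by
      rw [union_left_comm, union_comm Y]
      exact congrArg (· ∪ Y) (sup_union.symm.trans (by
        rw [union_comm, filter_union_filter_not_eq, P.sup_parts])))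

theorem exists_subset_absorb (P : Finpartition A) {X Y : Finset W} (hY : Y.Nonempty)
    (hX : X ∈ P.parts) : ∃ Z ∈ (absorb P hY).parts, X ⊆ Z := by
  by_cases hXY : (X ∩ Y).Nonempty
  · exact ⟨_, mem_union_right _ (mem_singleton_self _),
      (le_sup (f := id) (mem_filter.2 ⟨hX, hXY⟩)).trans subset_union_right⟩
  · exact ⟨X, mem_union_left _ (mem_filter.2 ⟨hX, hXY⟩), Subset.rfl⟩

theorem exists_superset_absorb (P : Finpartition A) {Y : Finset W} (hY : Y.Nonempty) :
    ∃ Z ∈ (absorb P hY).parts, Y ⊆ Z :=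
  ⟨_, mem_union_right _ (mem_singleton_self _), subset_union_left⟩

theorem IntersectingSupermodular.add_sum_le_absorb {p : Finset W → ℤ}
    (hp : IntersectingSupermodular p) (P : Finpartition A) {Y : Finset W} (hY : Y.Nonempty) :
    p Y + ∑ X ∈ P.parts, p X ≤
      ∑ X ∈ (absorb P hY).parts, p X + ∑ X ∈ P.parts with (X ∩ Y).Nonempty, p (X ∩ Y) := by
  have hmerge := hp.add_sum_le Y (S := {X ∈ P.parts | (X ∩ Y).Nonempty})
    (P.disjoint.subset (filter_subset _ _)) fun X hX => (mem_filter.1 hX).2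
  have hsplit := sum_filter_add_sum_filter_not P.parts (fun X => (X ∩ Y).Nonempty) p
  rw [absorb, sum_disjUnion, Finpartition.indiscrete_parts, sum_singleton,
    Finpartition.ofSubset_parts]
  linarith

/-- `M` and `m` arise from `P` and `Q` by repeatedly replacing two properly intersecting sets by
their union and their intersection. -/
structure IsUncrossing (P : Finpartition A) (Q : Finpartition B) (M : Finpartition (A ∪ B))
    (m : Finpartition (A ∩ B)) : Prop where
  exists_superset_left : ∀ X ∈ P.parts, ∃ Z ∈ M.parts, X ⊆ Z
  exists_superset_right : ∀ Y ∈ Q.parts, ∃ Z ∈ M.parts, Y ⊆ Z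
  sum_le : ∀ p : Finset W → ℤ, IntersectingSupermodular p →
    ∑ X ∈ P.parts, p X + ∑ Y ∈ Q.parts, p Y ≤ ∑ Z ∈ M.parts, p Z + ∑ Z ∈ m.parts, p Z

theorem IsUncrossing.absorb {P : Finpartition A} {Q : Finpartition B} {Y : Finset W}
    (hY : Y ∈ Q.parts) {M : Finpartition (A ∪ B \ Y)} {m : Finpartition (A ∩ (B \ Y))}
    (hMm : IsUncrossing P (Q.avoid Y) M m) :
    ∃ (M' : Finpartition (A ∪ B)) (m' : Finpartition (A ∩ B)), IsUncrossing P Q M' m' := by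
  have hYne := Q.nonempty_of_mem_parts hY
  have hYB := Q.subset hY
  have hdisj : Disjoint (A ∩ (B \ Y)) ((A ∪ B \ Y) ∩ Y) :=
    disjoint_sdiff_self_left.mono inter_subset_right inter_subset_right
  let M' : Finpartition (A ∪ B) :=
    (ForestPacking.absorb M hYne).copy (by rw [union_assoc, sdiff_union_of_subset hYB])
  let m' : Finpartition (A ∩ B) :=
    disjUnion m (M.restrict (inter_subset_left (s₂ := Y))) hdisj (by grind)
  have habsorb : ∀ {X : Finset W}, (∃ Z ∈ M.parts, X ⊆ Z) → ∃ Z ∈ M'.parts, X ⊆ Z := by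
    rintro X ⟨Z, hZ, hXZ⟩
    obtain ⟨Z', hZ', hZZ'⟩ := exists_subset_absorb M hYne hZ
    exact ⟨Z', hZ', hXZ.trans hZZ'⟩
  refine ⟨M', m', fun X hX => habsorb (hMm.exists_superset_left X hX), fun X hX => ?_,
    fun p hp => ?_⟩
  · rcases eq_or_ne X Y with rfl | hXY
    · exact exists_superset_absorb M hYne
    · exact habsorb (hMm.exists_superset_right X
        (parts_avoid_of_mem Q hY ▸ mem_erase.2 ⟨hXY, hX⟩))
  · have hsum := hMm.sum_le p hp
    have hrestrict : ∑ X ∈ (M.restrict (inter_subset_left (s₂ := Y))).parts, p X =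
        ∑ X ∈ M.parts with (X ∩ Y).Nonempty, p (X ∩ Y) := by
      have hinter : ∀ X ∈ M.parts, X ∩ ((A ∪ B \ Y) ∩ Y) = X ∩ Y := fun X hX => by
        rw [← inter_assoc, inter_eq_left.2 (M.subset hX)]
      rw [sum_restrict_parts, filter_congr fun X hX => by rw [hinter X hX]]
      exact sum_congr rfl fun X hX => by rw [hinter X (mem_filter.1 hX).1]
    have hY' := hp.add_sum_le_absorb M hYne
    rw [parts_avoid_of_mem Q hY] at hsum
    rw [sum_disjUnion, hrestrict, Finpartition.copy_parts, ← add_sum_erase _ _ hY]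
    linarith

theorem exists_isUncrossing (P : Finpartition A) (Q : Finpartition B) :
    ∃ (M : Finpartition (A ∪ B)) (m : Finpartition (A ∩ B)), IsUncrossing P Q M m := by
  induction B using Finset.strongInduction with
  | H B ih =>
    rcases B.eq_empty_or_nonempty with rfl | hB
    · refine ⟨P.copy (union_empty A).symm, Q.copy (inter_empty A).symm, fun X hX => ⟨X, hX, le_rfl⟩,
        fun Y hY => ?_, fun p _ => le_rfl⟩
      exact absurd (subset_empty.1 (Q.subset hY)) (Q.ne_empty hY)
    · obtain ⟨Y, hY⟩ := Q.parts_nonempty hB.ne_empty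
      obtain ⟨M, m, hMm⟩ := ih (B \ Y)
        (sdiff_ssubset (Q.subset hY) (Q.nonempty_of_mem_parts hY)) (Q.avoid Y)
      exact hMm.absorb hY

end Uncrossing

section CrossCount

variable {W β : Type*} [DecidableEq W] {A B C : Finset W} (E : Finset β) (s t : β → W)

/-- The number of edges of `E`, the ends of `e` being `s e` and `t e`, that have an end in some
part of `P` and are not contained in it. The part of a vertex outside of `A` is `∅`. -/
def crossCount (P : Finpartition A) : ℕ :=
  #{e ∈ E | P.part (s e) ≠ P.part (t e)}

theorem crossCount_add_sum_card_induced (P : Finpartition A) :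
    crossCount E s t P + ∑ X ∈ P.parts, #{e ∈ E | s e ∈ X ∧ t e ∈ X} =
      #{e ∈ E | s e ∈ A ∨ t e ∈ A} := by
  have hmaps : ∀ e ∈ {e ∈ E | (s e ∈ A ∨ t e ∈ A) ∧ P.part (s e) = P.part (t e)},
      P.part (s e) ∈ P.parts := by
    intro e he
    obtain ⟨-, hA, heq⟩ := mem_filter.1 he
    exact hA.elim P.part_mem.2 fun ht => heq ▸ P.part_mem.2 ht
  have hfiber : ∀ X ∈ P.parts,
      {e ∈ {e ∈ E | (s e ∈ A ∨ t e ∈ A) ∧ P.part (s e) = P.part (t e)} | P.part (s e) = X} =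
        {e ∈ E | s e ∈ X ∧ t e ∈ X} := by
    intro X hX
    simp only [filter_filter, ← P.part_eq_iff_mem hX]
    refine filter_congr fun e _ => ⟨fun h => ⟨h.2, h.1.2 ▸ h.2⟩, fun h => ⟨⟨.inl ?_, ?_⟩, h.1⟩⟩
    · exact P.subset hX ((P.part_eq_iff_mem hX).1 h.1)
    · rw [h.1, h.2]
  have hcross : {e ∈ E | (s e ∈ A ∨ t e ∈ A) ∧ P.part (s e) ≠ P.part (t e)} =
      {e ∈ E | P.part (s e) ≠ P.part (t e)} := by
    refine filter_congr fun e _ => and_iff_right_of_imp fun hne => ?_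
    by_contra! hA
    exact hne ((P.part_eq_empty.2 hA.1).trans (P.part_eq_empty.2 hA.2).symm)
  rw [← sum_congr rfl fun X hX => congrArg card (hfiber X hX),
    ← card_eq_sum_card_fiberwise hmaps, crossCount, ← hcross, add_comm, ← filter_filter,
    ← filter_filter]
  exact card_filter_add_card_filter_not _

theorem intersectingSupermodular_card_induced :
    IntersectingSupermodular fun X => (#{e ∈ E | s e ∈ X ∧ t e ∈ X} : ℤ) := by
  intro X Y _
  simp only [card_filter, Nat.cast_sum, ← sum_add_distrib]
  refine sum_le_sum fun e _ => ?_
  simp only [mem_union, mem_inter]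
  grind

theorem card_touching_union_add_inter_le (A B : Finset W) :
    #{e ∈ E | s e ∈ A ∪ B ∨ t e ∈ A ∪ B} + #{e ∈ E | s e ∈ A ∩ B ∨ t e ∈ A ∩ B} ≤
      #{e ∈ E | s e ∈ A ∨ t e ∈ A} + #{e ∈ E | s e ∈ B ∨ t e ∈ B} := by
  simp only [card_filter, ← sum_add_distrib]
  refine sum_le_sum fun e _ => ?_
  simp only [mem_union, mem_inter]
  grind

theorem IsUncrossing.crossCount_le {P : Finpartition A} {Q : Finpartition B}
    {M : Finpartition (A ∪ B)} {m : Finpartition (A ∩ B)} (hMm : IsUncrossing P Q M m) :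
    crossCount E s t M + crossCount E s t m ≤ crossCount E s t P + crossCount E s t Q := by
  have hinduced := hMm.sum_le _ (intersectingSupermodular_card_induced E s t)
  have htouch := card_touching_union_add_inter_le E s t A B
  have hP := crossCount_add_sum_card_induced E s t P
  have hQ := crossCount_add_sum_card_induced E s t Q
  have hM := crossCount_add_sum_card_induced E s t M
  have hm := crossCount_add_sum_card_induced E s t m
  norm_cast at hinduced
  lia

theorem crossCount_insert [DecidableEq β] {e : β} (he : e ∉ E) (P : Finpartition A) :
    crossCount (insert e E) s t P =
      crossCount E s t P + if P.part (s e) ≠ P.part (t e) then 1 else 0 := by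
  simp only [crossCount, card_filter, sum_insert he, add_comm]

end CrossCount

section Orientation

variable {W β : Type*} [DecidableEq W] {A B V : Finset W} {E : Finset β} {s t : β → W}
  {p : Finset W → ℤ}

/-- The number of edges of `E`, directed from `a e` to `b e`, that enter `X`. -/
def inDegree (E : Finset β) (a b : β → W) (X : Finset W) : ℕ :=
  #{e ∈ E | a e ∉ X ∧ b e ∈ X}

theorem inDegree_insert [DecidableEq β] {e : β} (he : e ∉ E) (a b : β → W) (X : Finset W) :
    inDegree (insert e E) a b X = inDegree E a b X + if a e ∉ X ∧ b e ∈ X then 1 else 0 := by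
  simp only [inDegree, card_filter, sum_insert he, add_comm]

theorem IntersectingSupermodular.sub_entering (hp : IntersectingSupermodular p) (x y : W) :
    IntersectingSupermodular fun X => p X - if x ∉ X ∧ y ∈ X then 1 else 0 := by
  intro X Y hXY
  have := hp X Y hXY
  simp only [mem_union, mem_inter]
  grind

theorem sum_entering (P : Finpartition A) (x y : W) :
    ∑ X ∈ P.parts, (if x ∉ X ∧ y ∈ X then 1 else 0 : ℤ) =
      if y ∈ A ∧ P.part x ≠ P.part y then 1 else 0 := by
  by_cases hy : y ∈ A
  · rw [sum_eq_single_of_mem _ (P.part_mem.2 hy)]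
    · simp only [P.mem_part_self.2 hy, hy, true_and, and_true, ne_eq,
        ← P.part_eq_iff_mem (P.part_mem.2 hy)]
    · intro X hX hne
      exact if_neg fun h => hne (P.part_eq_of_mem hX h.2).symm
  · rw [if_neg fun h => hy h.1]
    exact sum_eq_zero fun X hX => if_neg fun h => hy (P.subset hX h.2)

theorem notMem_of_orient_fails {x y : W} {P : Finpartition A} {n : ℕ}
    (hP : ∑ X ∈ P.parts, p X ≤ n + if P.part x ≠ P.part y then 1 else 0)
    (hfail : n < ∑ X ∈ P.parts, (p X - if x ∉ X ∧ y ∈ X then 1 else 0)) :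
    y ∉ A ∧ n < ∑ X ∈ P.parts, p X := by
  rw [sum_sub_distrib, sum_entering] at hfail
  have hne : P.part x ≠ P.part y := by
    intro h
    simp only [h, ne_eq, not_true_eq_false, and_false, if_false] at hP hfail
    lia
  have hy : y ∉ A := by
    intro hy
    simp only [hne, hy, ne_eq, not_false_eq_true, and_true, if_true] at hP hfail
    lia
  simp only [hy, false_and, if_false, sub_zero] at hfail
  exact ⟨hy, hfail⟩

theorem not_orient_fails_both [DecidableEq β] (hp : IntersectingSupermodular p) {e : β}
    (he : e ∉ E)
    (hle : ∀ A ⊆ V, ∀ P : Finpartition A, ∑ X ∈ P.parts, p X ≤ crossCount (insert e E) s t P)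
    (hA : A ⊆ V) (hB : B ⊆ V) (P : Finpartition A) (Q : Finpartition B)
    (hP : crossCount E s t P < ∑ X ∈ P.parts, (p X - if s e ∉ X ∧ t e ∈ X then 1 else 0)) :
    ∑ X ∈ Q.parts, (p X - if t e ∉ X ∧ s e ∈ X then 1 else 0) ≤ crossCount E s t Q := by
  by_contra! hQ
  simp only [crossCount_insert E s t he, Nat.cast_add, Nat.cast_ite, Nat.cast_one,
    Nat.cast_zero] at hle
  obtain ⟨htA, hP⟩ := notMem_of_orient_fails (hle A hA P) hP
  obtain ⟨hsB, hQ⟩ := notMem_of_orient_fails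
    (by simpa only [ne_comm] using hle B hB Q) hQ
  obtain ⟨M, m, hMm⟩ := exists_isUncrossing P Q
  have hM := hle _ (union_subset hA hB) M
  have hm := hle _ (inter_subset_left.trans hA) m
  have hpart : m.part (s e) = m.part (t e) := by
    rw [m.part_eq_empty.2 fun h => hsB (mem_inter.1 h).2,
      m.part_eq_empty.2 fun h => htA (mem_inter.1 h).1]
  have hcross := hMm.crossCount_le E s t
  have hsum := hMm.sum_le p hp
  rw [if_neg (not_not.2 hpart)] at hm
  split_ifs at hM <;> lia

/-- A theorem of Frank. If neither direction of an edge can be chosen, then uncrossing the two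
partitions that block them gives a violated partition. -/
theorem exists_orientation (hp : IntersectingSupermodular p)
    (hle : ∀ A ⊆ V, ∀ P : Finpartition A, ∑ X ∈ P.parts, p X ≤ crossCount E s t P) :
    ∃ a b : β → W, (∀ e ∈ E, s(a e, b e) = s(s e, t e)) ∧
      ∀ X ⊆ V, X.Nonempty → p X ≤ inDegree E a b X := by
  classical
  induction E using Finset.induction_on generalizing p with
  | empty =>
    refine ⟨s, t, fun _ _ => rfl, fun X hX hne => ?_⟩
    simpa [crossCount, inDegree] using hle X hX (Finpartition.indiscrete hne.ne_empty)
  | insert e E he ih =>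
    have extend : ∀ x y, s(x, y) = s(s e, t e) →
        (∀ A ⊆ V, ∀ P : Finpartition A,
          ∑ X ∈ P.parts, (p X - if x ∉ X ∧ y ∈ X then 1 else 0) ≤ crossCount E s t P) →
        ∃ a b : β → W, (∀ e' ∈ insert e E, s(a e', b e') = s(s e', t e')) ∧
          ∀ X ⊆ V, X.Nonempty → p X ≤ inDegree (insert e E) a b X := by
      intro x y hxy hle'
      obtain ⟨a, b, hab, hdeg⟩ := ih (hp.sub_entering x y) hle'
      refine ⟨Function.update a e x, Function.update b e y, fun e' he' => ?_, fun X hX hne => ?_⟩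
      · rcases eq_or_ne e' e with rfl | hne
        · simpa using hxy
        · simpa [hne] using hab e' (mem_of_mem_insert_of_ne he' hne)
      · have hold : inDegree E (Function.update a e x) (Function.update b e y) X =
            inDegree E a b X := congrArg card (filter_congr fun e' he' => by
          simp [ne_of_mem_of_not_mem he' he])
        rw [inDegree_insert he, hold, Function.update_self, Function.update_self]
        push_cast
        linarith [hdeg X hX hne]
    by_cases hst : ∀ A ⊆ V, ∀ P : Finpartition A,
        ∑ X ∈ P.parts, (p X - if s e ∉ X ∧ t e ∈ X then 1 else 0) ≤ crossCount E s t P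
    · exact extend _ _ rfl hst
    · push Not at hst
      obtain ⟨A, hA, P, hP⟩ := hst
      exact extend _ _ Sym2.eq_swap fun B hB Q => not_orient_fails_both hp he hle hA hB P Q hP

end Orientation

section InnerUncrossing

variable {W β : Type*} [DecidableEq W] {A B D : Finset W}

/-- The partition formed by the parts of `M` that are contained in `B`. -/
def within (M : Finpartition A) (B : Finset W) :
    Finpartition (sup {X ∈ M.parts | X ⊆ B} id) :=
  M.ofSubset (filter_subset _ _) rfl

/-- The partition of `A` that agrees with `m` on `B` and with the trace of `M` on `A \ B`. -/
def patch (M : Finpartition A) (m : Finpartition B) (hBA : B ⊆ A) : Finpartition A :=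
  disjUnion m (M.restrict (sdiff_subset (t := B))) disjoint_sdiff_self_right
    (union_sdiff_of_subset hBA)

theorem part_within (M : Finpartition A) (B : Finset W) (w : W) :
    (within M B).part w = if M.part w ⊆ B then M.part w else ∅ := by
  split_ifs with hB
  · by_cases hw : w ∈ A
    · exact (within M B).part_eq_of_mem (mem_filter.2 ⟨M.part_mem.2 hw, hB⟩) (M.mem_part_self.2 hw)
    · rw [M.part_eq_empty.2 hw, Finpartition.part_eq_empty, mem_sup]
      rintro ⟨X, hX, hwX⟩
      exact hw (M.subset (mem_filter.1 hX).1 hwX)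
  · rw [Finpartition.part_eq_empty, mem_sup]
    rintro ⟨X, hX, hwX⟩
    rw [M.part_eq_of_mem (mem_filter.1 hX).1 hwX] at hB
    exact hB (mem_filter.1 hX).2

theorem part_patch_of_mem (M : Finpartition A) (m : Finpartition B) (hBA : B ⊆ A) {w : W}
    (hw : w ∈ B) : (patch M m hBA).part w = m.part w :=
  (patch M m hBA).part_eq_of_mem (mem_union_left _ (m.part_mem.2 hw)) (m.mem_part_self.2 hw)

theorem part_patch_of_notMem (M : Finpartition A) (m : Finpartition B) (hBA : B ⊆ A) {w : W}
    (hw : w ∉ B) : (patch M m hBA).part w = M.part w ∩ (A \ B) := by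
  by_cases hwA : w ∈ A
  · have hmem : w ∈ M.part w ∩ (A \ B) :=
      mem_inter.2 ⟨M.mem_part_self.2 hwA, mem_sdiff.2 ⟨hwA, hw⟩⟩
    refine (patch M m hBA).part_eq_of_mem (mem_union_right _ ?_) hmem
    exact mem_erase.2 ⟨ne_empty_of_mem hmem, mem_image_of_mem _ (M.part_mem.2 hwA)⟩
  · rw [M.part_eq_empty.2 hwA, empty_inter, Finpartition.part_eq_empty]
    exact hwA

theorem sum_le_sum_within_add_sum_patch {p : Finset W → ℤ} (hanti : Antitone p)
    (M : Finpartition A) (m : Finpartition B) (hBA : B ⊆ A) :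
    ∑ X ∈ M.parts, p X + ∑ X ∈ m.parts, p X ≤
      ∑ X ∈ (within M B).parts, p X + ∑ X ∈ (patch M m hBA).parts, p X := by
  have htrace : ∑ X ∈ M.parts with ¬ X ⊆ B, p X ≤
      ∑ X ∈ (M.restrict (sdiff_subset (t := B))).parts, p X := by
    have hiff : ∀ X ∈ M.parts, (X ∩ (A \ B)).Nonempty ↔ ¬ X ⊆ B := fun X hX => by
      rw [← inter_sdiff_assoc, inter_eq_left.2 (M.subset hX), sdiff_nonempty]
    rw [sum_restrict_parts, filter_congr hiff]
    exact sum_le_sum fun X _ => hanti inter_subset_left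
  have hsplit := sum_filter_add_sum_filter_not M.parts (· ⊆ B) p
  rw [within, patch, sum_disjUnion, Finpartition.ofSubset_parts]
  linarith

theorem crossCount_within_add_crossCount_patch_le (E : Finset β) (s t : β → W)
    (M : Finpartition A) (m : Finpartition B) (hBA : B ⊆ A) :
    crossCount E s t (within M B) + crossCount E s t (patch M m hBA) ≤
      crossCount E s t M + crossCount E s t m := by
  simp only [crossCount, card_filter, ← sum_add_distrib]
  refine sum_le_sum fun e _ => ?_
  generalize s e = u, t e = v
  have hout : ∀ w ∉ B, m.part w = ∅ ∧ (within M B).part w = ∅ := fun w hw => by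
    refine ⟨m.part_eq_empty.2 hw, ?_⟩
    rw [part_within, ite_eq_right_iff]
    exact fun hMw => M.part_eq_empty.2 fun hwA => hw (hMw (M.mem_part_self.2 hwA))
  have hwithin : M.part u = M.part v → (within M B).part u = (within M B).part v := fun h => by
    rw [part_within, part_within, h]
  have hpart : ∀ w ∈ B, m.part w ≠ ∅ := fun w hw h => m.part_eq_empty.1 h hw
  by_cases hu : u ∈ B <;> by_cases hv : v ∈ B
  · rw [part_patch_of_mem M m hBA hu, part_patch_of_mem M m hBA hv]
    grind
  · have := part_patch_of_mem M m hBA hu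
    grind
  · have := part_patch_of_mem M m hBA hv
    grind
  · rw [part_patch_of_notMem M m hBA hu, part_patch_of_notMem M m hBA hv]
    grind

/-- Another way to uncross the partitions `P` and `Q`: the parts of `N` are unions of parts of `P`
as well as unions of parts of `Q`, while `O` covers the union of the ground sets. -/
structure IsInnerUncrossing (P : Finpartition A) (Q : Finpartition B) (N : Finpartition D)
    (O : Finpartition (A ∪ B)) : Prop where
  ground_subset : D ⊆ A ∩ B
  part_left_subset : ∀ Z ∈ N.parts, ∀ w ∈ Z, P.part w ⊆ Z
  part_right_subset : ∀ Z ∈ N.parts, ∀ w ∈ Z, Q.part w ⊆ Z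
  sum_le : ∀ p : Finset W → ℤ, IntersectingSupermodular p → Antitone p →
    ∑ X ∈ P.parts, p X + ∑ Y ∈ Q.parts, p Y ≤ ∑ Z ∈ N.parts, p Z + ∑ Z ∈ O.parts, p Z

theorem part_subset_of_exists_superset {P : Finpartition A} {M : Finpartition B}
    (hPM : ∀ X ∈ P.parts, ∃ Z ∈ M.parts, X ⊆ Z) {Z : Finset W} (hZ : Z ∈ M.parts) {w : W}
    (hw : w ∈ Z) : P.part w ⊆ Z := by
  by_cases hwA : w ∈ A
  · obtain ⟨Z', hZ', hsub⟩ := hPM _ (P.part_mem.2 hwA)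
    rwa [M.eq_of_mem_parts hZ hZ' hw (hsub (P.mem_part_self.2 hwA))]
  · rw [P.part_eq_empty.2 hwA]
    exact empty_subset Z

theorem exists_isInnerUncrossing (E : Finset β) (s t : β → W) (P : Finpartition A)
    (Q : Finpartition B) :
    ∃ (D : Finset W) (N : Finpartition D) (O : Finpartition (A ∪ B)), IsInnerUncrossing P Q N O ∧
      crossCount E s t N + crossCount E s t O ≤ crossCount E s t P + crossCount E s t Q := by
  obtain ⟨M, m, hMm⟩ := exists_isUncrossing P Q
  have hsub : A ∩ B ⊆ A ∪ B := inter_subset_left.trans subset_union_left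
  refine ⟨_, within M (A ∩ B), patch M m hsub, ⟨?_, ?_, ?_, ?_⟩, ?_⟩
  · exact Finset.sup_le fun X hX => (mem_filter.1 hX).2
  · exact fun Z hZ w hw =>
      part_subset_of_exists_superset hMm.exists_superset_left (mem_filter.1 hZ).1 hw
  · exact fun Z hZ w hw =>
      part_subset_of_exists_superset hMm.exists_superset_right (mem_filter.1 hZ).1 hw
  · exact fun p hp hanti =>
      (hMm.sum_le p hp).trans (sum_le_sum_within_add_sum_patch hanti M m hsub)
  · exact (crossCount_within_add_crossCount_patch_le E s t M m hsub).trans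
      (hMm.crossCount_le E s t)

theorem IsInnerUncrossing.card_parts {P : Finpartition A} {Q : Finpartition B}
    {N : Finpartition D} {O : Finpartition (A ∪ B)} (hNO : IsInnerUncrossing P Q N O) :
    #N.parts + #O.parts = #P.parts + #Q.parts := by
  have hle := hNO.sum_le _ (intersectingSupermodular_const 1) antitone_const
  have hge := hNO.sum_le _ (intersectingSupermodular_const (-1)) antitone_const
  simp only [sum_const, nsmul_eq_mul] at hle hge
  lia

end InnerUncrossing

section Colours

variable {W ι : Type*} [DecidableEq W] [DecidableEq ι] {A B D V : Finset W}

/-- The number of parts of `P` none of whose vertices has the colour `i`, where `C v` is the set of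
colours of the vertex `v`. -/
def freeCount (C : W → Finset ι) (i : ι) (P : Finpartition A) : ℕ :=
  #{X ∈ P.parts | i ∉ X.biUnion C}

/-- The number of vertices of `V` that have the colour `i`. -/
def colourCount (V : Finset W) (C : W → Finset ι) (i : ι) : ℕ :=
  #{v ∈ V | i ∈ C v}

/-- The assignment of colours obtained from `C` by giving the vertex `v` the colour `i`, too. -/
def addColour (C : W → Finset ι) (v : W) (i : ι) : W → Finset ι :=
  Function.update C v (insert i (C v))

variable {C : W → Finset ι} {i j : ι} {v : W}

theorem mem_addColour {w : W} : j ∈ addColour C v i w ↔ j ∈ C w ∨ w = v ∧ j = i := by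
  rcases eq_or_ne w v with rfl | hw
  · simp [addColour, or_comm]
  · simp [addColour, hw]

theorem subset_addColour (w : W) : C w ⊆ addColour C v i w :=
  fun _ hj => mem_addColour.2 (.inl hj)

theorem card_addColour_le {h : ℕ} (hC : ∀ w ∈ V, #(C w) ≤ h) (hv : #(C v) < h) :
    ∀ w ∈ V, #(addColour C v i w) ≤ h := by
  intro w hw
  rcases eq_or_ne w v with rfl | hwv
  · rw [addColour, Function.update_self]
    exact (card_insert_le _ _).trans hv
  · rw [addColour, Function.update_of_ne hwv]
    exact hC w hw

theorem colourCount_addColour (hv : v ∈ V) (hi : i ∉ C v) (j : ι) :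
    colourCount V (addColour C v i) j = colourCount V C j + if j = i then 1 else 0 := by
  split_ifs with hj
  · subst hj
    have hfilter : {w ∈ V | j ∈ addColour C v j w} = insert v {w ∈ V | j ∈ C w} := by
      ext w
      simp only [mem_filter, mem_addColour, mem_insert]
      grind
    have hnotMem : v ∉ {w ∈ V | j ∈ C w} := fun h => hi (mem_filter.1 h).2
    rw [colourCount, hfilter, card_insert_of_notMem hnotMem, colourCount]
  · simp only [colourCount, mem_addColour, hj, and_false, or_false, add_zero]

theorem freeCount_mono {C' : W → Finset ι} (hC : ∀ v, C v ⊆ C' v) (i : ι) (P : Finpartition A) :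
    freeCount C' i P ≤ freeCount C i P :=
  card_le_card (monotone_filter_right _ fun _ _ hX h =>
    hX (biUnion_mono (fun v _ => hC v) h))

theorem freeCount_addColour_lt {P : Finpartition A} {X : Finset W} (hX : X ∈ P.parts)
    (hiX : i ∉ X.biUnion C) (hv : v ∈ X) : freeCount (addColour C v i) i P < freeCount C i P := by
  refine card_lt_card (ssubset_iff_of_subset ?_ |>.2 ⟨X, mem_filter.2 ⟨hX, hiX⟩, fun h => ?_⟩)
  · exact monotone_filter_right _ fun _ _ hX h =>
      hX (biUnion_mono (fun v _ => subset_addColour v) h)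
  · exact (mem_filter.1 h).2 (mem_biUnion.2 ⟨v, hv, mem_addColour.2 (.inr ⟨rfl, rfl⟩)⟩)

theorem freeCount_avoid_of_mem {P : Finpartition A} {X : Finset W} (hX : X ∈ P.parts) :
    freeCount C j P = freeCount C j (P.avoid X) + if j ∉ X.biUnion C then 1 else 0 := by
  rw [freeCount, freeCount, parts_avoid_of_mem P hX, card_filter, card_filter,
    ← add_sum_erase _ _ hX, add_comm]

theorem freeCount_le_card {N : Finpartition D} {R : Finset (Finset W)} (hR : ∀ X ∈ R, X.Nonempty)
    (hN : ∀ Z ∈ N.parts, i ∉ Z.biUnion C → ∃ X ∈ R, X ⊆ Z) : freeCount C i N ≤ #R := by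
  refine card_le_card_of_forall_subsingleton (fun Z X => X ⊆ Z)
    (fun Z hZ => hN Z (mem_filter.1 hZ).1 (mem_filter.1 hZ).2) fun X hX Z hZ Z' hZ' => ?_
  obtain ⟨w, hw⟩ := hR X hX
  exact N.eq_of_mem_parts (mem_filter.1 hZ.1).1 (mem_filter.1 hZ'.1).1 (hZ.2 hw) (hZ'.2 hw)

theorem exists_free_part_subset {P : Finpartition A} {N : Finpartition D} (hDA : D ⊆ A)
    (hPN : ∀ Z ∈ N.parts, ∀ w ∈ Z, P.part w ⊆ Z) {Z : Finset W} (hZ : Z ∈ N.parts)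
    (hiZ : i ∉ Z.biUnion C) : ∃ X ∈ {X ∈ P.parts | i ∉ X.biUnion C}, X ⊆ Z := by
  obtain ⟨w, hw⟩ := N.nonempty_of_mem_parts hZ
  have hsub := hPN Z hZ w hw
  exact ⟨P.part w, mem_filter.2 ⟨P.part_mem.2 (hDA (N.subset hZ hw)),
    fun h => hiZ (biUnion_subset_biUnion_of_subset_left C hsub h)⟩, hsub⟩

theorem freeCount_le_freeCount {P : Finpartition A} {N : Finpartition D} (hDA : D ⊆ A)
    (hPN : ∀ Z ∈ N.parts, ∀ w ∈ Z, P.part w ⊆ Z) : freeCount C i N ≤ freeCount C i P :=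
  freeCount_le_card (fun _ hX => P.nonempty_of_mem_parts (mem_filter.1 hX).1)
    fun _ => exists_free_part_subset hDA hPN

theorem freeCount_lt_freeCount {P : Finpartition A} {N : Finpartition D} (hDA : D ⊆ A)
    (hPN : ∀ Z ∈ N.parts, ∀ w ∈ Z, P.part w ⊆ Z) {X : Finset W} (hX : X ∈ P.parts)
    (hiX : i ∉ X.biUnion C) (hXN : ∀ Z ∈ N.parts, i ∉ Z.biUnion C → ¬ X ⊆ Z) :
    freeCount C i N < freeCount C i P := by
  refine lt_of_le_of_lt (freeCount_le_card (R := {X ∈ P.parts | i ∉ X.biUnion C}.erase X)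
    (fun Y hY => P.nonempty_of_mem_parts (mem_filter.1 (mem_of_mem_erase hY)).1)
    fun Z hZ hiZ => ?_) (card_erase_lt_of_mem (mem_filter.2 ⟨hX, hiX⟩))
  obtain ⟨Y, hY, hYZ⟩ := exists_free_part_subset hDA hPN hZ hiZ
  exact ⟨Y, mem_erase.2 ⟨fun h => hXN Z hZ hiZ (h ▸ hYZ), hY⟩, hYZ⟩

theorem IsInnerUncrossing.freeCount_add_le {P : Finpartition A} {Q : Finpartition B}
    {N : Finpartition D} {O : Finpartition (A ∪ B)} (hNO : IsInnerUncrossing P Q N O) :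
    freeCount C i P + freeCount C i Q ≤ freeCount C i N + freeCount C i O := by
  have hmono : ∀ {X Y : Finset W}, X ⊆ Y → i ∈ X.biUnion C → i ∈ Y.biUnion C :=
    fun hXY h => biUnion_subset_biUnion_of_subset_left C hXY h
  have hanti : Antitone fun X : Finset W => if i ∉ X.biUnion C then (1 : ℤ) else 0 := by
    intro X Y hXY
    have := hmono hXY
    grind
  have hsuper : IntersectingSupermodular fun X : Finset W =>
      if i ∉ X.biUnion C then (1 : ℤ) else 0 := by
    intro X Y _
    have hX := hmono (inter_subset_left (s₁ := X) (s₂ := Y))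
    have hY := hmono (inter_subset_right (s₁ := X) (s₂ := Y))
    simp only [union_biUnion, mem_union]
    grind
  have hsum := hNO.sum_le _ hsuper hanti
  simp only [sum_boole] at hsum
  exact_mod_cast hsum

theorem sum_freeCount_add_sum_card [Fintype ι] (P : Finpartition A) :
    ∑ j, freeCount C j P + ∑ X ∈ P.parts, #(X.biUnion C) = Fintype.card ι * #P.parts := by
  have hfree : ∑ j, freeCount C j P = ∑ X ∈ P.parts, #(X.biUnion C)ᶜ := by
    simp only [freeCount, card_filter, compl_eq_univ_sdiff, sdiff_eq_filter]
    exact sum_comm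
  rw [hfree, ← sum_add_distrib, sum_congr rfl fun X _ => card_compl_add_card (X.biUnion C),
    sum_const, smul_eq_mul, mul_comm]

end Colours

section Roots

variable {W β ι : Type*} [DecidableEq W] [DecidableEq ι] [Fintype ι] {A B D V : Finset W}
  {E : Finset β} {s t : β → W} {h : ℕ} {C : W → Finset ι} {l : ι → ℕ} {i j : ι}

/-- The condition under which the sets `C v` of colours can be enlarged by giving each colour `j` to
at most `l j` further vertices in such a way that, for every partition `P` of a subset of `V`, the
edges that cross `P` can supply each part with the colours that it lacks, up to a total of `h`
colours per part. The subtraction is truncated. -/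
def RootCondition (V : Finset W) (E : Finset β) (s t : β → W) (h : ℕ) (C : W → Finset ι)
    (l : ι → ℕ) : Prop :=
  ∀ A ⊆ V, ∀ P : Finpartition A,
    ∑ j, (freeCount C j P - l j) + h * #P.parts ≤
      crossCount E s t P + Fintype.card ι * #P.parts

/-- The partition `P` attains equality in the root condition, and would violate it if the bound
`l i` were decreased. -/
structure IsCritical (E : Finset β) (s t : β → W) (h : ℕ) (C : W → Finset ι) (l : ι → ℕ) (i : ι)
    (P : Finpartition A) : Prop where
  tight : crossCount E s t P + Fintype.card ι * #P.parts ≤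
    ∑ j, (freeCount C j P - l j) + h * #P.parts
  le_freeCount : l i ≤ freeCount C i P

theorem RootCondition.isCritical_inner (hroot : RootCondition V E s t h C l) (hA : A ⊆ V)
    (hB : B ⊆ V) {P : Finpartition A} {Q : Finpartition B} {N : Finpartition D}
    {O : Finpartition (A ∪ B)} (hP : IsCritical E s t h C l i P) (hQ : IsCritical E s t h C l i Q)
    (hNO : IsInnerUncrossing P Q N O)
    (hcross : crossCount E s t N + crossCount E s t O ≤ crossCount E s t P + crossCount E s t Q) :
    IsCritical E s t h C l i N := by
  have hDA := hNO.ground_subset.trans inter_subset_left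
  have hDB := hNO.ground_subset.trans inter_subset_right
  have hleft : ∀ j, freeCount C j N ≤ freeCount C j P := fun j =>
    freeCount_le_freeCount hDA hNO.part_left_subset
  have hright : ∀ j, freeCount C j N ≤ freeCount C j Q := fun j =>
    freeCount_le_freeCount hDB hNO.part_right_subset
  have hexcess : ∀ j, (freeCount C j P - l j) + (freeCount C j Q - l j) ≤
      (freeCount C j N - l j) + (freeCount C j O - l j) := fun j => by
    have := hleft j
    have := hright j
    have := hNO.freeCount_add_le (C := C) (i := j)
    lia
  have hO := hroot _ (union_subset hA hB) O
  have hN := hroot D (hDA.trans hA) N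
  have hcard := hNO.card_parts
  have hcard_h := congrArg (h * ·) hcard
  have hcard_k := congrArg (Fintype.card ι * ·) hcard
  simp only [mul_add] at hcard_h hcard_k
  have hP_tight := hP.tight
  have hQ_tight := hQ.tight
  have hsum := sum_le_sum fun j (_ : j ∈ univ) => hexcess j
  simp only [sum_add_distrib] at hsum
  refine ⟨by lia, ?_⟩
  by_contra! hlt
  have hsum_lt := sum_lt_sum (fun j (_ : j ∈ univ) => hexcess j) ⟨i, mem_univ i, by
    have := hP.le_freeCount
    have := hQ.le_freeCount
    have := hNO.freeCount_add_le (C := C) (i := i)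
    lia⟩
  simp only [sum_add_distrib] at hsum_lt
  lia

theorem crossCount_avoid_le {P : Finpartition A} {X : Finset W} (hX : X ∈ P.parts) :
    crossCount E s t (P.avoid X) ≤ crossCount E s t P := by
  have hpart : ∀ w, (P.avoid X).part w = if P.part w = X then ∅ else P.part w := by
    intro w
    split_ifs with hw
    · rw [Finpartition.part_eq_empty, mem_sdiff, not_and_not_right]
      exact fun _ => (P.part_eq_iff_mem hX).1 hw
    · by_cases hwA : w ∈ A
      · refine (P.avoid X).part_eq_of_mem ?_ (P.mem_part_self.2 hwA)
        exact parts_avoid_of_mem P hX ▸ mem_erase.2 ⟨hw, P.part_mem.2 hwA⟩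
      · rw [P.part_eq_empty.2 hwA, Finpartition.part_eq_empty]
        exact fun h => hwA (mem_sdiff.1 h).1
  exact card_le_card (monotone_filter_right _ fun e _ hne heq =>
    hne (by rw [hpart, hpart, heq]))

theorem RootCondition.isCritical_avoid (hroot : RootCondition V E s t h C l) (hA : A ⊆ V)
    {P : Finpartition A} (hP : IsCritical E s t h C l i P) {X : Finset W} (hX : X ∈ P.parts)
    (hiX : i ∉ X.biUnion C) (hXh : h ≤ #(X.biUnion C)) :
    IsCritical E s t h C l i (P.avoid X) := by
  have hexcess : ∀ j, freeCount C j P - l j ≤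
      (freeCount C j (P.avoid X) - l j) + if j ∈ (X.biUnion C)ᶜ then 1 else 0 := fun j => by
    have := freeCount_avoid_of_mem (C := C) (j := j) hX
    simp only [mem_compl]
    lia
  have hsum := sum_le_sum fun j (_ : j ∈ univ) => hexcess j
  have hfree : ∑ j, (if j ∈ (X.biUnion C)ᶜ then 1 else 0) = #(X.biUnion C)ᶜ := by
    rw [sum_boole, filter_univ_mem, Nat.cast_id]
  have hcompl := card_compl_add_card (X.biUnion C)
  have hcross := crossCount_avoid_le (E := E) (s := s) (t := t) hX
  have hcard : #P.parts = #(P.avoid X).parts + 1 := by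
    rw [parts_avoid_of_mem P hX, card_erase_add_one hX]
  have hP_tight := hP.tight
  have hP_le := hP.le_freeCount
  have hP' := hroot (A \ X) (sdiff_subset.trans hA) (P.avoid X)
  rw [sum_add_distrib, hfree] at hsum
  rw [hcard, mul_add_one, mul_add_one] at hP_tight
  refine ⟨by lia, ?_⟩
  by_contra! hlt
  have hfree_i := freeCount_avoid_of_mem (C := C) (j := i) hX
  rw [if_pos hiX] at hfree_i
  have hsum_lt := sum_lt_sum (fun j (_ : j ∈ univ) => hexcess j) ⟨i, mem_univ i, by
    rw [if_pos (mem_compl.2 hiX)]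
    lia⟩
  rw [sum_add_distrib, hfree] at hsum_lt
  lia

theorem RootCondition.isCritical_of_violates (hroot : RootCondition V E s t h C l) (hi : 0 < l i)
    {C' : W → Finset ι} (hA : A ⊆ V) {P : Finpartition A}
    (hC : ∀ j, freeCount C' j P ≤ freeCount C j P)
    (hP : crossCount E s t P + Fintype.card ι * #P.parts <
      ∑ j, (freeCount C' j P - Function.update l i (l i - 1) j) + h * #P.parts) :
    IsCritical E s t h C l i P ∧ freeCount C' i P = freeCount C i P := by
  have hrootP := hroot A hA P
  have hothers : ∑ j ∈ univ.erase i, (freeCount C' j P - Function.update l i (l i - 1) j) ≤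
      ∑ j ∈ univ.erase i, (freeCount C j P - l j) := sum_le_sum fun j hj => by
    rw [Function.update_of_ne (ne_of_mem_erase hj)]
    exact Nat.sub_le_sub_right (hC j) _
  rw [← add_sum_erase univ _ (mem_univ i), Function.update_self] at hP
  have hsplit := add_sum_erase univ (fun j => freeCount C j P - l j) (mem_univ i)
  have hCi := hC i
  exact ⟨⟨by lia, by lia⟩, by lia⟩

theorem RootCondition.exists_isCritical_freeCount_lt_of_not_addColour
    (hroot : RootCondition V E s t h C l) (hi : 0 < l i) (hA : A ⊆ V) {P : Finpartition A}
    (hP : IsCritical E s t h C l i P) {X : Finset W} (hX : X ∈ P.parts) (hiX : i ∉ X.biUnion C)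
    {v : W} (hv : v ∈ X)
    (hplace : ¬ RootCondition V E s t h (addColour C v i) (Function.update l i (l i - 1))) :
    ∃ D ⊆ V, ∃ N : Finpartition D,
      IsCritical E s t h C l i N ∧ freeCount C i N < freeCount C i P := by
  simp only [RootCondition, not_forall, not_le] at hplace
  obtain ⟨B, hB, Q, hQ⟩ := hplace
  obtain ⟨hQ, hQfree⟩ := hroot.isCritical_of_violates hi hB
    (fun j => freeCount_mono subset_addColour j Q) hQ
  obtain ⟨D, N, O, hNO, hcross⟩ := exists_isInnerUncrossing E s t P Q
  have hDA := hNO.ground_subset.trans inter_subset_left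
  have hDB := hNO.ground_subset.trans inter_subset_right
  refine ⟨D, hDA.trans hA, N, hroot.isCritical_inner hA hB hP hQ hNO hcross,
    freeCount_lt_freeCount hDA hNO.part_left_subset hX hiX fun Z hZ hiZ hXZ => ?_⟩
  have hvB : v ∈ B := hDB (N.subset hZ (hXZ hv))
  refine (freeCount_addColour_lt (Q.part_mem.2 hvB) (fun hiQ => hiZ ?_)
    (Q.mem_part_self.2 hvB)).ne hQfree
  exact biUnion_subset_biUnion_of_subset_left C (hNO.part_right_subset Z hZ v (hXZ hv)) hiQ

theorem RootCondition.exists_isCritical_freeCount_lt (hroot : RootCondition V E s t h C l)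
    (hi : 0 < l i) (hA : A ⊆ V) {P : Finpartition A} (hP : IsCritical E s t h C l i P)
    (hplace : ∀ v ∈ V, #(C v) < h → i ∉ C v →
      ¬ RootCondition V E s t h (addColour C v i) (Function.update l i (l i - 1))) :
    ∃ D ⊆ V, ∃ N : Finpartition D,
      IsCritical E s t h C l i N ∧ freeCount C i N < freeCount C i P := by
  obtain ⟨X, hXfree⟩ := card_pos.1 (hi.trans_le hP.le_freeCount)
  obtain ⟨hX, hiX⟩ := mem_filter.1 hXfree
  obtain ⟨v, hv⟩ := P.nonempty_of_mem_parts hX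
  have hvC : C v ⊆ X.biUnion C := subset_biUnion_of_mem C hv
  by_cases hvh : #(C v) < h
  · exact hroot.exists_isCritical_freeCount_lt_of_not_addColour hi hA hP hX hiX hv
      (hplace v (hA (P.subset hX hv)) hvh fun hiv => hiX (hvC hiv))
  · have hfree := freeCount_avoid_of_mem (C := C) (j := i) hX
    rw [if_pos hiX] at hfree
    exact ⟨_, sdiff_subset.trans hA, P.avoid X,
      hroot.isCritical_avoid hA hP hX hiX ((not_lt.1 hvh).trans (card_le_card hvC)), by lia⟩

theorem RootCondition.exists_addColour (hroot : RootCondition V E s t h C l) (hi : 0 < l i) :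
    RootCondition V E s t h C (Function.update l i (l i - 1)) ∨
      ∃ v ∈ V, #(C v) < h ∧ i ∉ C v ∧
        RootCondition V E s t h (addColour C v i) (Function.update l i (l i - 1)) := by
  by_contra! hfail
  obtain ⟨hstay, hplace⟩ := hfail
  have hnone : ∀ n, ∀ A ⊆ V, ∀ P : Finpartition A, freeCount C i P = n →
      ¬ IsCritical E s t h C l i P := by
    intro n
    induction n using Nat.strong_induction_on with
    | _ n ih =>
      intro A hA P hn hP
      obtain ⟨D, hD, N, hN, hlt⟩ := hroot.exists_isCritical_freeCount_lt hi hA hP hplace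
      exact ih _ (hn ▸ hlt) D hD N rfl hN
  simp only [RootCondition, not_forall, not_le] at hstay
  obtain ⟨A, hA, P, hP⟩ := hstay
  exact hnone _ A hA P rfl (hroot.isCritical_of_violates hi hA (fun _ => le_rfl) hP).1

theorem RootCondition.exists_roots (hroot : RootCondition V E s t h C l)
    (hC : ∀ v ∈ V, #(C v) ≤ h) :
    ∃ C' : W → Finset ι, RootCondition V E s t h C' 0 ∧ (∀ v ∈ V, #(C' v) ≤ h) ∧
      ∀ i, colourCount V C' i ≤ colourCount V C i + l i := by
  induction hn : ∑ i, l i generalizing C l with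
  | zero =>
    obtain rfl : l = 0 := funext fun i => (sum_eq_zero_iff.1 hn) i (mem_univ i)
    exact ⟨C, hroot, hC, fun i => Nat.le_add_right _ _⟩
  | succ n ih =>
    obtain ⟨i, -, hi⟩ := exists_ne_zero_of_sum_ne_zero (hn.trans_ne n.succ_ne_zero)
    have hi : 0 < l i := Nat.pos_of_ne_zero hi
    have hupdate : ∀ j, Function.update l i (l i - 1) j + (if j = i then 1 else 0) = l j := by
      intro j
      rcases eq_or_ne j i with rfl | hj
      · rw [Function.update_self, if_pos rfl, Nat.sub_add_cancel hi]
      · rw [Function.update_of_ne hj, if_neg hj, add_zero]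
    have hsum : ∑ j, Function.update l i (l i - 1) j = n := by
      rw [← sum_congr rfl fun j _ => hupdate j, sum_add_distrib, sum_ite_eq' univ i,
        if_pos (mem_univ i)] at hn
      exact Nat.succ_injective hn
    rcases hroot.exists_addColour hi with hstay | ⟨v, hv, hvh, hiv, hplace⟩
    · obtain ⟨C', hroot', hC', hcount⟩ := ih hstay hC hsum
      exact ⟨C', hroot', hC', fun j => by have := hcount j; have := hupdate j; lia⟩
    · obtain ⟨C', hroot', hC', hcount⟩ := ih hplace (card_addColour_le hC hvh) hsum
      simp only [colourCount_addColour hv hiv] at hcount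
      exact ⟨C', hroot', hC', fun j => by have := hcount j; have := hupdate j; lia⟩

theorem RootCondition.sum_le_crossCount (hroot : RootCondition V E s t h C 0) (hA : A ⊆ V)
    (P : Finpartition A) :
    ∑ X ∈ P.parts, ((h : ℤ) - #(X.biUnion C)) ≤ crossCount E s t P := by
  have hP := hroot A hA P
  have hfree := sum_freeCount_add_sum_card (C := C) P
  simp only [Pi.zero_apply, Nat.sub_zero] at hP
  rw [sum_sub_distrib, sum_const, nsmul_eq_mul, mul_comm]
  zify at hP hfree
  linarith

end Roots

section Balance

variable {W ι : Type*} [DecidableEq ι] {V : Finset W} {h : ℕ} {C : W → Finset ι} {l : ι → ℕ}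
  {i j : ι}

theorem sum_colourCount [Fintype ι] (V : Finset W) (C : W → Finset ι) :
    ∑ j, colourCount V C j = ∑ v ∈ V, #(C v) := by
  simp only [colourCount, card_filter]
  rw [sum_comm]
  simp only [sum_boole, filter_univ_mem, Nat.cast_id]

theorem exists_mem_card_lt_of_sum_colourCount_lt [Fintype ι]
    (hsum : ∑ j, colourCount V C j < h * #V) : ∃ v ∈ V, #(C v) < h := by
  rw [sum_colourCount, mul_comm] at hsum
  by_contra! hle
  exact hsum.not_ge (card_nsmul_le_sum V _ h hle)

theorem exists_mem_notMem_of_colourCount_lt (hlt : colourCount V C i < #V) :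
    ∃ v ∈ V, i ∉ C v := by
  by_contra! hmem
  exact hlt.ne (congrArg card (filter_true_of_mem hmem))

/-- Since `v` has more colours than `w`, some colour `j` of `v` is not a colour of `w`; it is moved
from `v` to `w`, and `v` gets `i` instead. -/
theorem exists_colourCount_add_of_swap {v w : W} (hC : ∀ x ∈ V, #(C x) ≤ h) (hv : v ∈ V)
    (hw : w ∈ V) (hiv : i ∉ C v) (hiw : i ∈ C w) (hvh : h ≤ #(C v)) (hwh : #(C w) < h) :
    ∃ C' : W → Finset ι, (∀ x ∈ V, #(C' x) ≤ h) ∧ (∀ x ∈ V, C x ⊆ C' x ∨ h ≤ #(C' x)) ∧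
      ∀ c, colourCount V C' c = colourCount V C c + if c = i then 1 else 0 := by
  classical
  obtain ⟨j, hjv, hjw⟩ := exists_mem_notMem_of_card_lt_card (hwh.trans_le hvh)
  have hwv : w ≠ v := fun heq => hiv (heq ▸ hiw)
  set D := Function.update C v ((C v).erase j)
  have hD_self : D v = (C v).erase j := Function.update_self ..
  have hD_of_ne : ∀ {x}, x ≠ v → D x = C x := fun hx => Function.update_of_ne hx ..
  have hD_add : addColour D v j = C := by
    rw [addColour, hD_self, insert_erase hjv, Function.update_idem, Function.update_eq_self]
  have hj : j ∉ D v := hD_self ▸ notMem_erase j _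
  have hi : i ∉ D v := fun h => hiv (mem_of_mem_erase (hD_self ▸ h))
  have hcard : #(D v) + 1 = #(C v) := by rw [hD_self, card_erase_add_one hjv]
  have hDh : ∀ x ∈ V, #(D x) ≤ h := by
    intro x hx
    rcases eq_or_ne x v with rfl | hxv
    · exact (Nat.le_succ _).trans (hcard.trans_le (hC x hx))
    · exact hD_of_ne hxv ▸ hC x hx
  have hwi : addColour D v i w = C w := (Function.update_of_ne hwv _ _).trans (hD_of_ne hwv)
  refine ⟨addColour (addColour D v i) w j, card_addColour_le (card_addColour_le hDh
    (hcard.trans_le (hC v hv))) (hwi ▸ hwh), fun x _ => ?_, fun c => ?_⟩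
  · rcases eq_or_ne x v with rfl | hxv
    · right
      calc h ≤ #(C x) := hvh
        _ = #(addColour D x i x) := by
          rw [addColour, Function.update_self, card_insert_of_notMem hi, hcard]
        _ ≤ _ := card_le_card (subset_addColour x)
    · exact .inl (hD_of_ne hxv ▸ (subset_addColour x).trans (subset_addColour x))
  · have hD_count := colourCount_addColour hv hj c
    rw [hD_add] at hD_count
    rw [colourCount_addColour hw (hwi ▸ hjw), colourCount_addColour hv hi, hD_count]
    exact add_right_comm ..

theorem exists_colourCount_add [Fintype ι] (hC : ∀ v ∈ V, #(C v) ≤ h)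
    (hi : colourCount V C i < #V) (hsum : ∑ j, colourCount V C j < h * #V) :
    ∃ C' : W → Finset ι, (∀ v ∈ V, #(C' v) ≤ h) ∧ (∀ v ∈ V, C v ⊆ C' v ∨ h ≤ #(C' v)) ∧
      ∀ j, colourCount V C' j = colourCount V C j + if j = i then 1 else 0 := by
  classical
  by_cases hfree : ∃ v ∈ V, i ∉ C v ∧ #(C v) < h
  · obtain ⟨v, hv, hiv, hvh⟩ := hfree
    exact ⟨addColour C v i, card_addColour_le hC hvh, fun w _ => .inl (subset_addColour w),
      colourCount_addColour hv hiv⟩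
  · push Not at hfree
    obtain ⟨v, hv, hiv⟩ := exists_mem_notMem_of_colourCount_lt hi
    obtain ⟨w, hw, hwh⟩ := exists_mem_card_lt_of_sum_colourCount_lt hsum
    have hiw : i ∈ C w := by
      by_contra hiw
      exact hwh.not_ge (hfree w hw hiw)
    exact exists_colourCount_add_of_swap hC hv hw hiv hiw (hfree v hv hiv) hwh

theorem exists_colourCount_eq [Fintype ι] (hC : ∀ v ∈ V, #(C v) ≤ h)
    (hcount : ∀ i, colourCount V C i ≤ l i) (hlV : ∀ i, l i ≤ #V) (hsum : ∑ i, l i ≤ h * #V) :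
    ∃ C' : W → Finset ι, (∀ v ∈ V, #(C' v) ≤ h) ∧ (∀ v ∈ V, C v ⊆ C' v ∨ h ≤ #(C' v)) ∧
      ∀ i, colourCount V C' i = l i := by
  induction hn : ∑ i, (l i - colourCount V C i) using Nat.strong_induction_on generalizing C with
  | _ n ih =>
    by_cases hall : ∀ i, colourCount V C i = l i
    · exact ⟨C, hC, fun _ _ => .inl subset_rfl, hall⟩
    push Not at hall
    obtain ⟨i, hi⟩ := hall
    have hi : colourCount V C i < l i := lt_of_le_of_ne (hcount i) hi
    have hlt : ∑ j, colourCount V C j < ∑ j, l j :=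
      sum_lt_sum (fun j _ => hcount j) ⟨i, mem_univ i, hi⟩
    obtain ⟨D, hD, hCD, hDcount⟩ :=
      exists_colourCount_add hC (hi.trans_le (hlV i)) (hlt.trans_le hsum)
    have hDl : ∀ j, colourCount V D j ≤ l j := by
      intro j
      rw [hDcount]
      split_ifs with hj
      · exact hj ▸ hi
      · exact hcount j
    have hdecr : ∑ j, (l j - colourCount V D j) < n := by
      rw [← hn]
      refine sum_lt_sum (fun j _ => ?_) ⟨i, mem_univ i, ?_⟩
      · exact Nat.sub_le_sub_left ((Nat.le_add_right _ _).trans_eq (hDcount j).symm) _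
      · have := hDcount i
        rw [if_pos rfl] at this
        lia
    obtain ⟨C', hC', hDC', hC'count⟩ := ih _ hdecr hD hDl rfl
    refine ⟨C', hC', fun v hv => ?_, hC'count⟩
    rcases hDC' v hv with hsub | hfull
    · exact (hCD v hv).imp hsub.trans' fun h => h.trans (card_le_card hsub)
    · exact .inr hfull

end Balance

section Branchings

variable {W β ι : Type*} [DecidableEq W] [DecidableEq ι] {V X Y Z : Finset W} {E : Finset β}
  {a b s t : β → W} {h : ℕ} {C : W → Finset ι} {v w : W} {c : ι}

/-- The condition of Edmonds' theorem on packing branchings: the edges of `E`, with `e` directed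
from `a e` to `b e`, can supply every non-empty subset of `V` with the colours that it lacks, up to
a total of `h` colours. -/
def CoverCondition (V : Finset W) (E : Finset β) (a b : β → W) (h : ℕ) (C : W → Finset ι) : Prop :=
  ∀ X ⊆ V, X.Nonempty → h ≤ inDegree E a b X + #(X.biUnion C)

/-- A set that attains equality in the cover condition. -/
structure IsTight (V : Finset W) (E : Finset β) (a b : β → W) (h : ℕ) (C : W → Finset ι)
    (X : Finset W) : Prop where
  subset : X ⊆ V
  eq : inDegree E a b X + #(X.biUnion C) = h

theorem CoverCondition.of_subset_or_le_card {C' : W → Finset ι} (hC : CoverCondition V E a b h C)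
    (hC' : ∀ v ∈ V, C v ⊆ C' v ∨ h ≤ #(C' v)) : CoverCondition V E a b h C' := by
  intro X hX hne
  by_cases hfull : ∃ v ∈ X, h ≤ #(C' v)
  · obtain ⟨v, hv, hvh⟩ := hfull
    exact (hvh.trans (card_le_card (subset_biUnion_of_mem C' hv))).trans (Nat.le_add_left _ _)
  · push Not at hfull
    exact (hC X hX hne).trans (Nat.add_le_add_left (card_le_card (biUnion_mono fun v hv =>
      (hC' v (hX hv)).resolve_right (hfull v hv).not_ge)) _)

theorem biUnion_inter_subset (X Y : Finset W) (C : W → Finset ι) :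
    (X ∩ Y).biUnion C ⊆ X.biUnion C ∩ Y.biUnion C :=
  subset_inter (biUnion_subset_biUnion_of_subset_left C inter_subset_left)
    (biUnion_subset_biUnion_of_subset_left C inter_subset_right)

theorem intersectingSupermodular_sub_card_biUnion (n : ℤ) (C : W → Finset ι) :
    IntersectingSupermodular fun X => n - #(X.biUnion C) := by
  intro X Y _
  have hinter := card_le_card (biUnion_inter_subset X Y C)
  have hunion := card_union_add_card_inter (X.biUnion C) (Y.biUnion C)
  simp only [union_biUnion]
  lia

theorem RootCondition.exists_coverCondition [Fintype ι] (hroot : RootCondition V E s t h C 0) :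
    ∃ a b : β → W, (∀ e ∈ E, s(a e, b e) = s(s e, t e)) ∧ CoverCondition V E a b h C := by
  obtain ⟨a, b, hab, hdeg⟩ := exists_orientation (intersectingSupermodular_sub_card_biUnion h C)
    fun A hA P => hroot.sum_le_crossCount hA P
  exact ⟨a, b, hab, fun X hX hne => by have := hdeg X hX hne; lia⟩

theorem inDegree_union_add_inter_le (E : Finset β) (a b : β → W) (X Y : Finset W) :
    inDegree E a b (X ∪ Y) + inDegree E a b (X ∩ Y) ≤ inDegree E a b X + inDegree E a b Y := by
  simp only [inDegree, card_filter, ← sum_add_distrib]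
  refine sum_le_sum fun e _ => ?_
  simp only [mem_union, mem_inter]
  grind

theorem IsTight.inter (hX : IsTight V E a b h C X) (hY : IsTight V E a b h C Y)
    (hC : CoverCondition V E a b h C) (hXY : (X ∩ Y).Nonempty) :
    IsTight V E a b h C (X ∩ Y) ∧ X.biUnion C ∩ Y.biUnion C ⊆ (X ∩ Y).biUnion C := by
  have hdeg := inDegree_union_add_inter_le E a b X Y
  have hsub := biUnion_inter_subset X Y C
  have hcard := card_le_card hsub
  have hunion := card_union_add_card_inter (X.biUnion C) (Y.biUnion C)
  have hC_inter := hC (X ∩ Y) (inter_subset_left.trans hX.subset) hXY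
  have hC_union := hC (X ∪ Y) (union_subset hX.subset hY.subset)
    (hXY.mono (inter_subset_left.trans subset_union_left))
  have hX_eq := hX.eq
  have hY_eq := hY.eq
  rw [union_biUnion] at hC_union
  exact ⟨⟨inter_subset_left.trans hX.subset, by lia⟩,
    (eq_of_subset_of_card_le hsub (by lia)).superset⟩

theorem IsTight.inDegree_add_card_lt (hX : IsTight V E a b h C X) (hv : v ∈ X)
    (hc : c ∈ X.biUnion C) (hcv : c ∉ C v) : inDegree E a b X + #(C v) < h := by
  have hlt := card_lt_card
    ((ssubset_iff_of_subset (subset_biUnion_of_mem C hv)).2 ⟨c, hc, hcv⟩)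
  have := hX.eq
  lia

theorem CoverCondition.exists_isTight_of_not_addColour [DecidableEq β]
    (hC : CoverCondition V E a b h C) {e : β} (he : e ∈ E)
    (hfail : ¬ CoverCondition V (E.erase e) a b h (addColour C (b e) c)) :
    ∃ Z, IsTight V E a b h C Z ∧ a e ∉ Z ∧ b e ∈ Z ∧ c ∈ Z.biUnion C := by
  simp only [CoverCondition, not_forall, not_le] at hfail
  obtain ⟨Z, hZ, hne, hlt⟩ := hfail
  have hle := hC Z hZ hne
  have hdeg := inDegree_insert (notMem_erase e E) a b Z
  rw [insert_erase he] at hdeg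
  have hsub : Z.biUnion C ⊆ Z.biUnion (addColour C (b e) c) :=
    biUnion_mono fun w _ => subset_addColour w
  have hcard := card_le_card hsub
  by_cases henters : a e ∉ Z ∧ b e ∈ Z
  · rw [if_pos henters] at hdeg
    refine ⟨Z, ⟨hZ, by lia⟩, henters.1, henters.2, ?_⟩
    rw [eq_of_subset_of_card_le hsub (by lia)]
    exact mem_biUnion.2 ⟨b e, henters.2, mem_addColour.2 (.inr ⟨rfl, rfl⟩)⟩
  · rw [if_neg henters] at hdeg
    lia

theorem CoverCondition.exists_edge_within (hC : CoverCondition V E a b h C) (hX : X ⊆ V)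
    (hv : v ∈ X) (hlt : inDegree E a b X + #(C v) < h) :
    ∃ e ∈ E, a e ∈ X ∧ b e ∈ X ∧ ¬ C (a e) ⊆ C v ∧ C (b e) ⊆ C v := by
  by_contra! hnone
  set Y := {w ∈ X | C w ⊆ C v}
  have hY := hC Y ((filter_subset _ _).trans hX) ⟨v, mem_filter.2 ⟨hv, subset_rfl⟩⟩
  have hcolours : #(Y.biUnion C) ≤ #(C v) :=
    card_le_card (biUnion_subset.2 fun w hw => (mem_filter.1 hw).2)
  have hdeg : inDegree E a b Y ≤ inDegree E a b X := by
    refine card_le_card (monotone_filter_right _ fun e he hent => ?_)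
    obtain ⟨hbX, hbv⟩ := mem_filter.1 hent.2
    exact ⟨fun haX => hnone e he haX hbX (fun h => hent.1 (mem_filter.2 ⟨haX, h⟩)) hbv, hbX⟩
  lia

theorem CoverCondition.exists_addColour_of_isTight [DecidableEq β]
    (hC : CoverCondition V E a b h C) (hX : X = V ∨ IsTight V E a b h C X) (hv : v ∈ X)
    (hlt : inDegree E a b X + #(C v) < h) :
    ∃ e ∈ E, ∃ c ∈ C (a e), c ∉ C (b e) ∧ #(C (b e)) < h ∧
      CoverCondition V (E.erase e) a b h (addColour C (b e) c) := by
  induction X using Finset.strongInduction generalizing v with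
  | H X ih =>
    have hXV : X ⊆ V := hX.elim (fun h => h.subset) (·.subset)
    obtain ⟨e, he, haX, hbX, hav, hbv⟩ := hC.exists_edge_within hXV hv hlt
    obtain ⟨c, hca, hcv⟩ := not_subset.1 hav
    have hcb : c ∉ C (b e) := fun h => hcv (hbv h)
    by_cases hgood : CoverCondition V (E.erase e) a b h (addColour C (b e) c)
    · exact ⟨e, he, c, hca, hcb,
        (card_le_card hbv).trans_lt ((Nat.le_add_left _ _).trans_lt hlt), hgood⟩
    obtain ⟨Z, hZ, haZ, hbZ, hcZ⟩ := hC.exists_isTight_of_not_addColour he hgood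
    have hb : b e ∈ X ∩ Z := mem_inter.2 ⟨hbX, hbZ⟩
    obtain ⟨htight, hcolours⟩ : IsTight V E a b h C (X ∩ Z) ∧
        X.biUnion C ∩ Z.biUnion C ⊆ (X ∩ Z).biUnion C := by
      rcases hX with rfl | hX
      · rw [inter_eq_right.2 hZ.subset]
        exact ⟨hZ, inter_subset_right⟩
      · exact hX.inter hZ hC ⟨b e, hb⟩
    have hcX : c ∈ X.biUnion C := mem_biUnion.2 ⟨a e, haX, hca⟩
    exact ih (X ∩ Z) (ssubset_iff_of_subset inter_subset_left |>.2
      ⟨a e, haX, fun h => haZ (mem_inter.1 h).2⟩) (.inr htight) hb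
      (htight.inDegree_add_card_lt hb (hcolours (mem_inter.2 ⟨hcX, hcZ⟩)) hcb)

theorem CoverCondition.exists_addColour [DecidableEq β] (hC : CoverCondition V E a b h C)
    (hE : ∀ e ∈ E, a e ∈ V) (hv : v ∈ V) (hvh : #(C v) < h) :
    ∃ e ∈ E, ∃ c ∈ C (a e), c ∉ C (b e) ∧ #(C (b e)) < h ∧
      CoverCondition V (E.erase e) a b h (addColour C (b e) c) := by
  have hdeg : inDegree E a b V = 0 :=
    card_eq_zero.2 (filter_eq_empty_iff.2 fun e he h => h.1 (hE e he))
  exact hC.exists_addColour_of_isTight (.inl rfl) hv (by rwa [hdeg, zero_add])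

end Branchings

section Forests

variable {α β : Type*} {G H : Graph α β} {e : β} {u v x y : α}

theorem reachableSet_subset (hx : x ∈ H.vertexSet) : reachableSet H x ⊆ H.vertexSet := by
  intro y hy
  rcases Relation.ReflTransGen.cases_tail hy with rfl | ⟨z, -, hz⟩
  · exact hx
  · exact hz.right_mem

theorem reachableSet_eq_of_adj (h : H.Adj x y) : reachableSet H x = reachableSet H y :=
  Set.ext fun _ => ⟨.head h.symm, .head h⟩

theorem components_eq_image (H : Graph α β) : components H = reachableSet H '' H.vertexSet :=
  Set.ext fun _ => exists_congr fun _ => and_congr_right fun _ => eq_comm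

theorem isForest_noEdge (S : Set α) : IsForest (Graph.noEdge S β) :=
  fun _ _ _ h => by simpa using h.2.2 0

theorem reachableSet_noEdge (S : Set α) (x : α) : reachableSet (Graph.noEdge S β) x = {x} := by
  refine Set.eq_singleton_iff_unique_mem.2 ⟨.refl, fun y hy => ?_⟩
  rcases Relation.ReflTransGen.cases_tail hy with rfl | ⟨z, -, f, hf⟩
  · rfl
  · simp at hf

theorem numComponents_noEdge (S : Set α) : numComponents (Graph.noEdge S β) = S.ncard := by
  rw [numComponents, components_eq_image, funext (reachableSet_noEdge S)]
  exact Set.ncard_image_of_injective _ Set.singleton_injective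

/-- The graph `H` together with a further edge `e` that joins the vertex `u` of `H` to `v`. It is
used for vertices `v` outside of `H`, which become leaves. -/
def addEdge (H : Graph α β) (hu : u ∈ H.vertexSet) (he : e ∉ H.edgeSet) (v : α) : Graph α β where
  vertexSet := insert v H.vertexSet
  IsLink f x y := H.IsLink f x y ∨ f = e ∧ (x = u ∧ y = v ∨ x = v ∧ y = u)
  isLink_symm := fun f _ => ⟨fun x y => Or.imp Graph.IsLink.symm
    (And.imp_right fun h => h.symm.imp And.symm And.symm)⟩
  eq_or_eq_of_isLink_of_isLink := by
    rintro f x y x' y' (hf | ⟨hfe, h⟩) (hf' | ⟨hfe', h'⟩)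
    · exact hf.left_eq_or_eq hf'
    · exact absurd (hfe' ▸ hf.edge_mem) he
    · exact absurd (hfe ▸ hf'.edge_mem) he
    · grind
  left_mem_of_isLink := by
    rintro f x y (hf | ⟨-, ⟨rfl, -⟩ | ⟨rfl, -⟩⟩)
    · exact .inr hf.left_mem
    · exact .inr hu
    · exact .inl rfl

variable {hu : u ∈ H.vertexSet} {he : e ∉ H.edgeSet}

theorem edgeSet_addEdge : (addEdge H hu he v).edgeSet = insert e H.edgeSet := by
  ext f
  constructor
  · rintro ⟨x, y, hf | ⟨rfl, -⟩⟩
    · exact .inr hf.edge_mem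
    · exact .inl rfl
  · rintro (rfl | hf)
    · exact ⟨u, v, .inr ⟨rfl, .inl ⟨rfl, rfl⟩⟩⟩
    · obtain ⟨x, y, hf⟩ := H.exists_isLink_of_mem_edgeSet hf
      exact ⟨x, y, .inl hf⟩

theorem adj_addEdge : (addEdge H hu he v).Adj u v :=
  ⟨e, .inr ⟨rfl, .inl ⟨rfl, rfl⟩⟩⟩

theorem addEdge_le (hH : H ≤ G) (h : G.IsLink e u v) : addEdge H hu he v ≤ G := by
  refine ⟨Set.insert_subset h.right_mem hH.vertexSet_mono, ?_⟩
  rintro f x y (hf | ⟨rfl, ⟨rfl, rfl⟩ | ⟨rfl, rfl⟩⟩)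
  · exact hf.mono hH
  · exact h
  · exact h.symm

/-- A cycle through `v` would have to use the edge `e` twice. -/
theorem IsForest.addEdge (hH : IsForest H) (hv : v ∉ H.vertexSet) :
    IsForest (addEdge H hu he v) := by
  rintro n x f ⟨hx, hf, hlink⟩
  have huv : u ≠ v := ne_of_mem_of_not_mem hu hv
  have hinc : ∀ i, x i = v ∨ x (i + 1) = v → f i = e := by
    rintro i hi
    rcases hlink i with h | h
    · rcases hi with hi | hi
      · exact absurd (hi ▸ h.left_mem) hv
      · exact absurd (hi ▸ h.right_mem) hv
    · exact h.1
  have havoid : ∀ i, x i ≠ v := by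
    intro i hi
    have hprev : i - 1 = i :=
      hf ((hinc (i - 1) (.inr (by rwa [sub_add_cancel]))).trans (hinc i (.inl hi)).symm)
    rcases hlink i with h | ⟨-, h | h⟩
    · exact hv (hi ▸ h.left_mem)
    · exact huv (h.1.symm.trans hi)
    · rw [← sub_eq_iff_eq_add.1 hprev] at h
      exact huv (h.2.symm.trans hi)
  refine hH n x f ⟨hx, hf, fun i => ?_⟩
  rcases hlink i with h | ⟨-, h | h⟩
  · exact h
  · exact absurd h.2 (havoid _)
  · exact absurd h.1 (havoid _)

theorem mem_reachableSet_addEdge (hx : x ∈ H.vertexSet) (hv : v ∉ H.vertexSet) :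
    y ∈ reachableSet (addEdge H hu he v) x ↔
      y ∈ reachableSet H x ∨ y = v ∧ u ∈ reachableSet H x := by
  have huv : u ≠ v := ne_of_mem_of_not_mem hu hv
  have hmono : ∀ {y}, y ∈ reachableSet H x → y ∈ reachableSet (addEdge H hu he v) x :=
    fun hy => Relation.ReflTransGen.mono (fun _ _ ⟨f, hf⟩ => ⟨f, .inl hf⟩) _ _ hy
  constructor
  · intro hy
    induction hy with
    | refl => exact .inl .refl
    | tail _ hyz ih =>
      obtain ⟨f, hf | ⟨-, ⟨rfl, rfl⟩ | ⟨rfl, rfl⟩⟩⟩ := hyz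
      · rcases ih with ih | ⟨rfl, -⟩
        · exact .inl (ih.tail ⟨f, hf⟩)
        · exact absurd hf.left_mem hv
      · exact .inr ⟨rfl, ih.resolve_right fun h => huv h.1⟩
      · rcases ih with ih | ih
        · exact absurd (reachableSet_subset hx ih) hv
        · exact .inl ih.2
  · rintro (hy | ⟨rfl, hy⟩)
    · exact hmono hy
    · exact (hmono hy).tail adj_addEdge

theorem components_addEdge (hv : v ∉ H.vertexSet) :
    components (addEdge H hu he v) =
      (fun S => {y | y ∈ S ∨ y = v ∧ u ∈ S}) '' components H := by
  have hreach : ∀ x ∈ H.vertexSet, reachableSet (addEdge H hu he v) x =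
      {y | y ∈ reachableSet H x ∨ y = v ∧ u ∈ reachableSet H x} :=
    fun x hx => Set.ext fun y => mem_reachableSet_addEdge hx hv
  have hleaf : reachableSet (addEdge H hu he v) v = reachableSet (addEdge H hu he v) u :=
    (reachableSet_eq_of_adj adj_addEdge).symm
  rw [components_eq_image, components_eq_image, Set.image_image, ← Set.image_congr hreach]
  change _ '' insert v H.vertexSet = _
  rw [Set.image_insert_eq, hleaf, Set.insert_eq_of_mem (Set.mem_image_of_mem _ hu)]

theorem numComponents_addEdge (hv : v ∉ H.vertexSet) :
    numComponents (addEdge H hu he v) = numComponents H := by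
  rw [numComponents, components_addEdge hv, numComponents]
  refine Set.InjOn.ncard_image fun S hS T hT hST => ?_
  have hnotMem : ∀ S ∈ components H, v ∉ S := by
    rintro _ ⟨x, hx, rfl⟩ hvx
    exact hv (reachableSet_subset hx hvx)
  ext y
  rcases eq_or_ne y v with rfl | hy
  · exact iff_of_false (hnotMem S hS) (hnotMem T hT)
  · simpa [hy] using Set.ext_iff.1 hST y

end Forests

section Packings

variable {α β ι : Type*} {G : Graph α β} {F : ι → Graph α β} {e : β} {u v : α} {c i : ι}

/-- The graphs `F i` are pairwise edge-disjoint forests in `G`. -/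
structure IsForestPacking (G : Graph α β) (F : ι → Graph α β) : Prop where
  le : ∀ i, F i ≤ G
  isForest : ∀ i, IsForest (F i)
  edgeDisjoint : ∀ i j, i ≠ j → Disjoint (F i).edgeSet (F j).edgeSet

theorem isForestPacking_noEdge {S : ι → Set α} (hS : ∀ i, S i ⊆ G.vertexSet) :
    IsForestPacking G fun i => Graph.noEdge (S i) β where
  le i := Graph.noEdge_le_iff.2 (hS i)
  isForest i := isForest_noEdge (S i)
  edgeDisjoint i j _ := by simp

theorem IsForestPacking.update_addEdge [DecidableEq ι] (hF : IsForestPacking G F)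
    (hlink : G.IsLink e u v) (hu : u ∈ (F c).vertexSet) (hv : v ∉ (F c).vertexSet)
    (he : ∀ i, e ∉ (F i).edgeSet) :
    IsForestPacking G (Function.update F c (addEdge (F c) hu (he c) v)) := by
  have hdisj : ∀ i ≠ c, Disjoint (addEdge (F c) hu (he c) v).edgeSet (F i).edgeSet := by
    intro i hi
    rw [edgeSet_addEdge, Set.disjoint_insert_left]
    exact ⟨he i, hF.edgeDisjoint c i hi.symm⟩
  refine ⟨(Function.forall_update_iff F fun _ H => H ≤ G).2
      ⟨addEdge_le (hF.le c) hlink, fun i _ => hF.le i⟩,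
    (Function.forall_update_iff F fun _ H => IsForest H).2
      ⟨(hF.isForest c).addEdge hv, fun i _ => hF.isForest i⟩, fun i j hij => ?_⟩
  rcases eq_or_ne i c with rfl | hi
  · rw [Function.update_self, Function.update_of_ne hij.symm]
    exact hdisj j hij.symm
  · rw [Function.update_of_ne hi]
    rcases eq_or_ne j c with rfl | hj
    · rw [Function.update_self]
      exact (hdisj i hi).symm
    · rw [Function.update_of_ne hj]
      exact hF.edgeDisjoint i j hij

variable [Fintype ι]

open Classical in
/-- The indices of the graphs `F i` that contain the vertex `v`: these are the colours of `v`. -/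
noncomputable def graphsAt (F : ι → Graph α β) (v : α) : Finset ι :=
  {i | v ∈ (F i).vertexSet}

theorem mem_graphsAt : i ∈ graphsAt F v ↔ v ∈ (F i).vertexSet := by
  simp only [graphsAt, mem_filter_univ]

theorem graphsAt_update_addEdge [DecidableEq α] [DecidableEq ι] (hu : u ∈ (F c).vertexSet)
    (he : e ∉ (F c).edgeSet) :
    graphsAt (Function.update F c (addEdge (F c) hu he v)) = addColour (graphsAt F) v c := by
  ext w i
  rw [mem_addColour, mem_graphsAt, mem_graphsAt]
  rcases eq_or_ne i c with rfl | hi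
  · rw [Function.update_self]
    simp only [and_true, or_comm (b := w = v)]
    rfl
  · rw [Function.update_of_ne hi]
    simp only [hi, and_false, or_false]

theorem CoverCondition.exists_isForestPacking [DecidableEq α] [DecidableEq ι] {V : Finset α}
    {R : Finset β} {a b : β → α} {h : ℕ} (hcover : CoverCondition V R a b h (graphsAt F))
    (hlink : ∀ e ∈ R, G.IsLink e (a e) (b e)) (hR : ∀ e ∈ R, a e ∈ V)
    (hcard : ∀ v ∈ V, #(graphsAt F v) ≤ h) (hF : IsForestPacking G F)
    (hdisj : ∀ e ∈ R, ∀ i, e ∉ (F i).edgeSet) :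
    ∃ F' : ι → Graph α β, IsForestPacking G F' ∧ (∀ v ∈ V, #(graphsAt F' v) = h) ∧
      ∀ i, numComponents (F' i) = numComponents (F i) := by
  classical
  induction R using Finset.strongInduction generalizing F with
  | H R ih =>
    by_cases hfull : ∀ v ∈ V, #(graphsAt F v) = h
    · exact ⟨F, hF, hfull, fun _ => rfl⟩
    push Not at hfull
    obtain ⟨v, hv, hvh⟩ := hfull
    obtain ⟨e, he, c, hca, hcb, hlt, hcover'⟩ :=
      hcover.exists_addColour hR hv ((hcard v hv).lt_of_ne hvh)
    rw [mem_graphsAt] at hca hcb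
    rw [← graphsAt_update_addEdge hca (hdisj e he c)] at hcover'
    obtain ⟨F', hF', hregular, hcomponents⟩ := ih (R.erase e) (erase_ssubset he) hcover'
      (fun f hf => hlink f (mem_of_mem_erase hf)) (fun f hf => hR f (mem_of_mem_erase hf))
      (by rw [graphsAt_update_addEdge]; exact card_addColour_le hcard hlt)
      (hF.update_addEdge (hlink e he) hca hcb (hdisj e he))
      fun f hf => (Function.forall_update_iff F fun _ H => f ∉ H.edgeSet).2
        ⟨by
          rw [edgeSet_addEdge, Set.mem_insert_iff, not_or]
          exact ⟨ne_of_mem_erase hf, hdisj f (mem_of_mem_erase hf) c⟩,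
        fun i _ => hdisj f (mem_of_mem_erase hf) i⟩
    refine ⟨F', hF', hregular, fun i => (hcomponents i).trans ?_⟩
    exact (Function.forall_update_iff F fun i H => numComponents H = numComponents (F i)).2
      ⟨numComponents_addEdge hcb, fun _ _ => rfl⟩ i

end Packings

section Labels

variable {α β γ : Type*} {G H : Graph α β} {f : α → γ} {S : Set α}

/-- The edges of `G` whose ends have different labels `f`. -/
def bichromaticEdges (G : Graph α β) (f : α → γ) : Set β :=
  {e | ∃ x y, G.IsLink e x y ∧ f x ≠ f y}

theorem bichromaticEdges_subset_edgeSet : bichromaticEdges G f ⊆ G.edgeSet :=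
  fun _ ⟨_, _, h, _⟩ => h.edge_mem

theorem bichromaticEdges_mono (h : H ≤ G) : bichromaticEdges H f ⊆ bichromaticEdges G f :=
  fun _ ⟨x, y, he, hxy⟩ => ⟨x, y, he.mono h, hxy⟩

theorem bichromaticEdges_eq {s t : β → α} (hst : ∀ e ∈ G.edgeSet, G.IsLink e (s e) (t e)) :
    bichromaticEdges G f = {e ∈ G.edgeSet | f (s e) ≠ f (t e)} := by
  ext e
  refine ⟨fun ⟨x, y, he, hxy⟩ => ⟨he.edge_mem, ?_⟩, fun ⟨he, hne⟩ => ⟨s e, t e, hst e he, hne⟩⟩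
  rcases (hst e he.edge_mem).eq_and_eq_or_eq_and_eq he with ⟨hs, ht⟩ | ⟨hs, ht⟩
  · rwa [hs, ht]
  · rw [hs, ht]
    exact hxy.symm

/-- The parts of the partition `P` of `S` are the sets of the elements of `S` with a common
label. -/
def IsLabelling (P : Finpartition S) (f : α → γ) : Prop :=
  ∀ X ∈ P.parts, ∀ x ∈ X, ∀ y ∈ S, y ∈ X ↔ f y = f x

theorem exists_mem_parts (P : Finpartition S) {x : α} (hx : x ∈ S) : ∃ X ∈ P.parts, x ∈ X := by
  have hsup := P.sup_parts
  rw [sup_set_eq_biUnion] at hsup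
  simpa using hsup.symm.subset hx

theorem eq_of_mem_of_mem {P : Finpartition S} {X Y : Set α} (hX : X ∈ P.parts) (hY : Y ∈ P.parts)
    {x : α} (hxX : x ∈ X) (hxY : x ∈ Y) : X = Y :=
  P.disjoint.eq hX hY (Set.not_disjoint_iff.2 ⟨x, hxX, hxY⟩)

theorem exists_isLabelling (P : Finpartition S) : ∃ f : α → Set α, IsLabelling P f := by
  have hpart : ∀ x, ∃ X : Set α, x ∈ S → X ∈ P.parts ∧ x ∈ X := by
    intro x
    by_cases hx : x ∈ S
    · exact (exists_mem_parts P hx).imp fun _ h _ => h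
    · exact ⟨∅, fun h => absurd h hx⟩
  choose f hf using hpart
  have hfX : ∀ X ∈ P.parts, ∀ x ∈ X, f x = X := fun X hX x hx =>
    have hfx := hf x (P.le hX hx)
    eq_of_mem_of_mem hfx.1 hX hfx.2 hx
  refine ⟨f, fun X hX x hx y hy => ?_⟩
  rw [hfX X hX x hx]
  exact ⟨hfX X hX y, fun h => h ▸ (hf y hy).2⟩

theorem exists_finpartition_isLabelling (hS : S.Finite) (f : α → γ) :
    ∃ P : Finpartition S, IsLabelling P f := by
  classical
  have hmem : ∀ {X}, X ∈ hS.toFinset.image (fun x => {y ∈ S | f y = f x}) ↔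
      ∃ x ∈ S, {y ∈ S | f y = f x} = X := by simp
  refine ⟨⟨hS.toFinset.image fun x => {y ∈ S | f y = f x}, ?_, ?_, ?_⟩, ?_⟩
  · rw [supIndep_iff_pairwiseDisjoint]
    intro X hX Y hY hXY
    obtain ⟨x, -, rfl⟩ := hmem.1 hX
    obtain ⟨y, -, rfl⟩ := hmem.1 hY
    refine Set.disjoint_left.2 fun z hzx hzy => hXY ?_
    simp only [← hzx.2, ← hzy.2]
  · rw [sup_set_eq_biUnion]
    ext x
    simp only [Set.mem_iUnion, hmem, id, exists_prop]
    exact ⟨by rintro ⟨_, ⟨x, -, rfl⟩, hx⟩; exact hx.1, fun hx => ⟨_, ⟨x, hx, rfl⟩, hx, rfl⟩⟩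
  · intro hbot
    obtain ⟨x, hx, hempty⟩ := hmem.1 hbot
    exact Set.notMem_empty x (hempty.subset ⟨hx, rfl⟩)
  · intro X hX x hx y hy
    obtain ⟨z, -, rfl⟩ := hmem.1 hX
    rw [hx.2]
    exact and_iff_right hy

theorem IsLabelling.ncard_image {P : Finpartition S} (hf : IsLabelling P f) :
    (f '' S).ncard = #P.parts := by
  have heq : ∀ X ∈ P.parts, ∀ x ∈ X, {y ∈ S | f y = f x} = X := fun X hX x hx =>
    Set.ext fun y => ⟨fun hy => (hf X hX x hx y hy.1).2 hy.2,
      fun hy => ⟨P.le hX hy, (hf X hX x hx y (P.le hX hy)).1 hy⟩⟩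
  have hparts : (P.parts : Set (Set α)) = (fun c => {y ∈ S | f y = c}) '' (f '' S) := by
    ext X
    rw [Set.image_image]
    constructor
    · intro hX
      obtain ⟨x, hx⟩ := Set.nonempty_iff_ne_empty.2 (P.ne_bot hX)
      exact ⟨x, P.le hX hx, heq X hX x hx⟩
    · rintro ⟨x, hx, rfl⟩
      obtain ⟨X, hX, hxX⟩ := exists_mem_parts P hx
      simpa only [heq X hX x hxX, mem_coe] using hX
  rw [← Set.ncard_coe_finset, hparts]
  refine (Set.InjOn.ncard_image ?_).symm
  rintro _ ⟨x, hx, rfl⟩ c - hc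
  exact (hc.subset ⟨hx, rfl⟩).2

theorem IsLabelling.crossingNumber_eq {P : Finpartition G.vertexSet} (hf : IsLabelling P f) :
    crossingNumber G P = (bichromaticEdges G f).ncard := by
  refine congrArg Set.ncard (Set.ext fun e => ⟨?_, ?_⟩)
  · rintro ⟨-, X, hX, x, y, he, hx, hy⟩
    exact ⟨x, y, he, fun hxy => hy ((hf X hX x hx y he.right_mem).2 hxy.symm)⟩
  · rintro ⟨x, y, he, hxy⟩
    obtain ⟨X, hX, hx⟩ := exists_mem_parts P he.left_mem
    exact ⟨he.edge_mem, X, hX, x, y, he, hx,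
      fun hy => hxy ((hf X hX x hx y he.right_mem).1 hy).symm⟩

end Labels

section Necessity

variable {α β γ : Type*} {G H : Graph α β}

theorem exists_isLink_of_mem_reachableSet {x y : α} {T : Set α} (hxy : y ∈ reachableSet H x)
    (hx : x ∉ T) (hy : y ∈ T) : ∃ e z z', H.IsLink e z z' ∧ z ∉ T ∧ z' ∈ T := by
  by_contra! hclosed
  refine absurd hy ?_
  clear hy
  induction hxy with
  | refl => exact hx
  | tail _ hyz ih =>
    obtain ⟨e, he⟩ := hyz
    exact hclosed e _ _ he ih

/-- Adding the labels outside of `S` to `S` one by one uses a new edge for each of them. -/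
theorem ncard_image_le_add_of_reaches (hV : H.vertexSet.Finite) (hE : H.edgeSet.Finite)
    (f : α → γ) (S : Set γ) (hreach : ∀ x ∈ H.vertexSet, ∃ y ∈ reachableSet H x, f y ∈ S)
    (hS : S ⊆ f '' H.vertexSet) :
    (f '' H.vertexSet).ncard ≤
      S.ncard + {e | ∃ x y, H.IsLink e x y ∧ f x ≠ f y ∧ f x ∉ S}.ncard := by
  have hfin : (f '' H.vertexSet).Finite := hV.image f
  induction hn : (f '' H.vertexSet \ S).ncard using Nat.strong_induction_on generalizing S with
  | _ n ih =>
    by_cases hall : f '' H.vertexSet ⊆ S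
    · exact (Set.ncard_le_ncard hall (hfin.subset hS)).trans (Nat.le_add_right _ _)
    obtain ⟨_, ⟨x, hx, rfl⟩, hxS⟩ := Set.not_subset.1 hall
    obtain ⟨y, hxy, hyS⟩ := hreach x hx
    obtain ⟨e, z, z', he, hz, hz'⟩ :=
      exists_isLink_of_mem_reachableSet (T := f ⁻¹' S) hxy hxS hyS
    have hzV : f z ∈ f '' H.vertexSet := ⟨z, he.left_mem, rfl⟩
    have hlt : (f '' H.vertexSet \ insert (f z) S).ncard < n := by
      rw [← hn]
      refine Set.ncard_lt_ncard ?_ (hfin.subset Set.sdiff_subset)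
      refine (Set.ssubset_iff_of_subset ?_).2 ⟨f z, ⟨hzV, hz⟩, fun h => h.2 (.inl rfl)⟩
      exact Set.sdiff_subset_sdiff_right (Set.subset_insert _ _)
    have hstep := ih _ hlt (insert (f z) S)
      (fun x hx => (hreach x hx).imp fun y hy => ⟨hy.1, .inr hy.2⟩) (Set.insert_subset hzV hS) rfl
    have hinsert := Set.ncard_insert_le (f z) S
    have hne : f z ≠ f z' := fun heq => hz (Set.mem_preimage.2 (heq ▸ hz'))
    have hedges : {e | ∃ x y, H.IsLink e x y ∧ f x ≠ f y ∧ f x ∉ insert (f z) S}.ncard <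
        {e | ∃ x y, H.IsLink e x y ∧ f x ≠ f y ∧ f x ∉ S}.ncard := by
      refine Set.ncard_lt_ncard ?_ (hE.subset fun e ⟨x, y, h, _⟩ => h.edge_mem)
      refine (Set.ssubset_iff_of_subset ?_).2 ⟨e, ⟨z, z', he, hne, hz⟩, ?_⟩
      · rintro e ⟨x, y, h, hne, hn⟩
        exact ⟨x, y, h, hne, fun hS => hn (.inr hS)⟩
      · rintro ⟨x, y, h, hne, hn⟩
        rcases he.eq_and_eq_or_eq_and_eq h with ⟨rfl, rfl⟩ | ⟨rfl, rfl⟩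
        · exact hn (.inl rfl)
        · exact hn (.inr hz')
    lia

theorem ncard_image_le (hV : H.vertexSet.Finite) (hE : H.edgeSet.Finite) (f : α → γ) :
    (f '' H.vertexSet).ncard ≤ numComponents H + (bichromaticEdges H f).ncard := by
  obtain ⟨R, hRV, hR⟩ := Set.exists_subset_bijOn H.vertexSet (reachableSet H)
  have hreach : ∀ x ∈ H.vertexSet, ∃ y ∈ reachableSet H x, f y ∈ f '' R := by
    intro x hx
    obtain ⟨y, hy, hyx⟩ := hR.surjOn ⟨x, hx, rfl⟩
    exact ⟨y, hyx.subset .refl, y, hy, rfl⟩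
  have hcard : (f '' R).ncard ≤ numComponents H := by
    rw [numComponents, components_eq_image, ← hR.image_eq, hR.injOn.ncard_image]
    exact Set.ncard_image_le (hV.subset hRV)
  refine (ncard_image_le_add_of_reaches hV hE f (f '' R) hreach (Set.image_mono hRV)).trans
    (add_le_add hcard (Set.ncard_le_ncard ?_ (hE.subset bichromaticEdges_subset_edgeSet)))
  rintro e ⟨x, y, he, hxy, -⟩
  exact ⟨x, y, he, hxy⟩

theorem numComponents_le_ncard (hV : H.vertexSet.Finite) :
    numComponents H ≤ H.vertexSet.ncard := by
  rw [numComponents, components_eq_image]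
  exact Set.ncard_image_le hV

theorem sum_ncard_bichromaticEdges_le {ι : Type*} [Fintype ι] {F : ι → Graph α β}
    (hE : G.edgeSet.Finite) (hle : ∀ i, F i ≤ G)
    (hdisj : ∀ i j, i ≠ j → Disjoint (F i).edgeSet (F j).edgeSet) (f : α → γ) :
    ∑ i, (bichromaticEdges (F i) f).ncard ≤ (bichromaticEdges G f).ncard := by
  have hfin := hE.subset (bichromaticEdges_subset_edgeSet (f := f))
  rw [← finsum_eq_sum_of_fintype, ← Set.ncard_iUnion_of_finite
    (fun i => hfin.subset (bichromaticEdges_mono (hle i)))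
    fun i j hij => (hdisj i j hij).mono bichromaticEdges_subset_edgeSet
      bichromaticEdges_subset_edgeSet]
  exact Set.ncard_le_ncard (Set.iUnion_subset fun i => bichromaticEdges_mono (hle i)) hfin

variable {h k : ℕ} {F : Fin k → Graph α β}

theorem IsRegularForestPacking.card_graphsAt (hF : IsRegularForestPacking G h k F) {v : α}
    (hv : v ∈ G.vertexSet) : #(graphsAt F v) = h := by
  rw [← hF.regular v hv, ← Set.ncard_coe_finset]
  exact congrArg Set.ncard (Set.ext fun i => mem_graphsAt)

theorem colourCount_graphsAt {V : Finset α} {i : Fin k} (hV : (F i).vertexSet ⊆ V) :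
    colourCount V (graphsAt F) i = (F i).vertexSet.ncard := by
  rw [colourCount, ← Set.ncard_coe_finset]
  refine congrArg Set.ncard (Set.ext fun v => ?_)
  simp only [coe_filter, mem_graphsAt]
  exact and_iff_right_of_imp fun hv => hV hv

theorem IsRegularForestPacking.sum_ncard_vertexSet (hF : IsRegularForestPacking G h k F)
    (hV : G.vertexSet.Finite) : ∑ i, (F i).vertexSet.ncard = h * G.vertexSet.ncard := by
  have hcount : ∀ i, colourCount hV.toFinset (graphsAt F) i = (F i).vertexSet.ncard := fun i =>
    colourCount_graphsAt (by simpa using (hF.le i).vertexSet_mono)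
  rw [← sum_congr rfl fun i _ => hcount i, sum_colourCount,
    sum_congr rfl fun v hv => hF.card_graphsAt (hV.mem_toFinset.1 hv), sum_const, smul_eq_mul,
    ← Set.ncard_eq_toFinset_card _ hV, mul_comm]

theorem IsRegularForestPacking.mul_ncard_image_le (hF : IsRegularForestPacking G h k F)
    (hV : G.vertexSet.Finite) (f : α → γ) :
    h * (f '' G.vertexSet).ncard ≤ ∑ i, (f '' (F i).vertexSet).ncard := by
  classical
  have hfin := hV.image f
  have hcount : ∀ i, (f '' (F i).vertexSet).ncard =
      #{c ∈ hfin.toFinset | c ∈ f '' (F i).vertexSet} := by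
    intro i
    rw [← Set.ncard_coe_finset]
    refine congrArg Set.ncard (Set.ext fun c => ?_)
    simpa using fun x hx hc => ⟨x, (hF.le i).vertexSet_mono hx, hc⟩
  rw [sum_congr rfl fun i _ => hcount i]
  simp only [card_filter]
  rw [sum_comm, mul_comm, Set.ncard_eq_toFinset_card _ hfin, ← smul_eq_mul]
  refine card_nsmul_le_sum _ _ _ fun c hc => ?_
  obtain ⟨v, hv, rfl⟩ := hfin.mem_toFinset.1 hc
  rw [← card_filter, ← hF.card_graphsAt hv]
  exact card_le_card fun i hi => mem_filter.2 ⟨mem_univ i, v, mem_graphsAt.1 hi, rfl⟩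

theorem IsRegularForestPacking.mul_card_parts_le (hF : IsRegularForestPacking G h k F)
    (hV : G.vertexSet.Finite) (hE : G.edgeSet.Finite) (P : Finpartition G.vertexSet) :
    h * #P.parts ≤ ∑ i, min (numComponents (F i)) #P.parts + crossingNumber G P := by
  obtain ⟨f, hf⟩ := exists_isLabelling P
  rw [hf.crossingNumber_eq, ← hf.ncard_image]
  have hlabels : ∀ i, (f '' (F i).vertexSet).ncard ≤
      min (numComponents (F i)) (f '' G.vertexSet).ncard + (bichromaticEdges (F i) f).ncard := by
    intro i
    have hle := (hF.le i).vertexSet_mono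
    have hcomponents := ncard_image_le (hV.subset hle) (hE.subset (hF.le i).edgeSet_mono) f
    have himage := Set.ncard_le_ncard (Set.image_mono (f := f) hle) (hV.image f)
    lia
  calc h * (f '' G.vertexSet).ncard
      ≤ ∑ i, (f '' (F i).vertexSet).ncard := hF.mul_ncard_image_le hV f
    _ ≤ ∑ i, min (numComponents (F i)) (f '' G.vertexSet).ncard +
          ∑ i, (bichromaticEdges (F i) f).ncard := by
        rw [← sum_add_distrib]
        exact sum_le_sum fun i _ => hlabels i
    _ ≤ _ := by
        gcongr
        exact sum_ncard_bichromaticEdges_le hE hF.le hF.edgeDisjoint f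

end Necessity

section Sufficiency

variable {α β γ ι : Type*} {G : Graph α β} {h : ℕ} [Fintype ι] {l : ι → ℕ}

theorem mul_le_sum_min_add_of_succ {q c : ℕ}
    (hq : h * (q + 1) ≤ ∑ i, min (l i) (q + 1) + c) : h * q ≤ ∑ i, min (l i) q + c := by
  have hsucc : ∑ i, min (l i) (q + 1) = ∑ i, min (l i) q + #{i | q < l i} := by
    rw [card_filter, ← sum_add_distrib]
    exact sum_congr rfl fun i _ => by grind
  rcases le_total #{i | q < l i} h with hle | hle
  · rw [mul_add, mul_one] at hq
    lia
  · calc h * q ≤ #{i | q < l i} * q := by gcongr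
      _ ≤ ∑ i with q < l i, min (l i) q := by
        rw [← smul_eq_mul]
        exact card_nsmul_le_sum _ _ _ fun i hi => le_min (mem_filter.1 hi).2.le le_rfl
      _ ≤ ∑ i, min (l i) q := sum_le_sum_of_subset (filter_subset _ _)
      _ ≤ ∑ i, min (l i) q + c := Nat.le_add_right _ _

theorem mul_ncard_image_le_of_finpartition (hV : G.vertexSet.Finite)
    (hcond : ∀ P : Finpartition G.vertexSet,
      h * #P.parts ≤ ∑ i, min (l i) #P.parts + crossingNumber G P) (f : α → γ) :
    h * (f '' G.vertexSet).ncard ≤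
      ∑ i, min (l i) (f '' G.vertexSet).ncard + (bichromaticEdges G f).ncard := by
  obtain ⟨P, hP⟩ := exists_finpartition_isLabelling hV f
  rw [hP.ncard_image, ← hP.crossingNumber_eq]
  exact hcond P

theorem card_image_part [DecidableEq α] {V A : Finset α} (hA : A ⊆ V) (P : Finpartition A) :
    #(V.image P.part) = #P.parts ∨ #(V.image P.part) = #P.parts + 1 := by
  have hlower : P.parts ⊆ V.image P.part := by
    intro X hX
    obtain ⟨x, hx, hxX⟩ := P.part_surjOn hX
    exact mem_image.2 ⟨x, hA hx, hxX⟩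
  have hupper : V.image P.part ⊆ insert ∅ P.parts := by
    refine image_subset_iff.2 fun x _ => mem_insert.2 ?_
    by_cases hx : x ∈ A
    · exact .inr (P.part_mem.2 hx)
    · exact .inl (P.part_eq_empty.2 hx)
  have := card_le_card hlower
  have := (card_le_card hupper).trans (card_insert_le _ _)
  lia

theorem rootCondition_empty [DecidableEq α] [DecidableEq ι] (hV : G.vertexSet.Finite)
    (hE : G.edgeSet.Finite) {s t : β → α} (hst : ∀ e ∈ G.edgeSet, G.IsLink e (s e) (t e))
    (hcond : ∀ f : α → Finset α, h * (f '' G.vertexSet).ncard ≤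
      ∑ i, min (l i) (f '' G.vertexSet).ncard + (bichromaticEdges G f).ncard) :
    RootCondition hV.toFinset hE.toFinset s t h (fun _ => ∅) l := by
  intro A hA P
  have hcross : (bichromaticEdges G P.part).ncard = crossCount hE.toFinset s t P := by
    rw [bichromaticEdges_eq hst, crossCount, ← Set.ncard_coe_finset]
    simp
  have himage : (P.part '' G.vertexSet).ncard = #(hV.toFinset.image P.part) := by
    rw [← Set.ncard_coe_finset, coe_image, hV.coe_toFinset]
  have hparts : h * #P.parts ≤ ∑ i, min (l i) #P.parts + crossCount hE.toFinset s t P := by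
    have hlabels := hcond P.part
    rw [himage, hcross] at hlabels
    rcases card_image_part hA P with hcard | hcard
    · rwa [hcard] at hlabels
    · rw [hcard] at hlabels
      exact mul_le_sum_min_add_of_succ hlabels
  have hfree : ∀ i, freeCount (fun _ => (∅ : Finset ι)) i P = #P.parts := fun i => by
    simp [freeCount]
  have hsum : ∑ i, (#P.parts - l i) + ∑ i, min (l i) #P.parts = Fintype.card ι * #P.parts := by
    rw [← sum_add_distrib, sum_congr rfl fun i _ => (by lia : _ = #P.parts), sum_const, card_univ,
      smul_eq_mul]
  simp only [hfree]
  lia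

theorem exists_ends [Nonempty α] (G : Graph α β) :
    ∃ s t : β → α, ∀ e ∈ G.edgeSet, G.IsLink e (s e) (t e) := by
  have hends : ∀ e, ∃ x y, e ∈ G.edgeSet → G.IsLink e x y := by
    intro e
    by_cases he : e ∈ G.edgeSet
    · obtain ⟨x, y, hxy⟩ := G.exists_isLink_of_mem_edgeSet he
      exact ⟨x, y, fun _ => hxy⟩
    · exact ⟨Classical.arbitrary α, Classical.arbitrary α, fun h => absurd h he⟩
  choose s t hst using hends
  exact ⟨s, t, hst⟩

theorem exists_coverCondition [Nonempty α] [DecidableEq α] [DecidableEq ι]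
    (hV : G.vertexSet.Finite) (hE : G.edgeSet.Finite)
    (hlV : ∀ i, l i ≤ G.vertexSet.ncard) (hsum : ∑ i, l i ≤ h * G.vertexSet.ncard)
    (hcond : ∀ P : Finpartition G.vertexSet,
      h * #P.parts ≤ ∑ i, min (l i) #P.parts + crossingNumber G P) :
    ∃ (a b : β → α) (C : α → Finset ι), (∀ e ∈ G.edgeSet, G.IsLink e (a e) (b e)) ∧
      CoverCondition hV.toFinset hE.toFinset a b h C ∧ (∀ v ∈ hV.toFinset, #(C v) ≤ h) ∧
      ∀ i, colourCount hV.toFinset C i = l i := by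
  obtain ⟨s, t, hst⟩ := exists_ends G
  rw [Set.ncard_eq_toFinset_card _ hV] at hlV hsum
  have hroot := rootCondition_empty hV hE hst (mul_ncard_image_le_of_finpartition hV hcond)
  obtain ⟨C₁, hroot₁, hC₁, hcount₁⟩ := hroot.exists_roots (by simp)
  obtain ⟨a, b, hab, hcover⟩ := hroot₁.exists_coverCondition
  obtain ⟨C, hC, hC₁C, hcount⟩ := exists_colourCount_eq hC₁
    (fun i => (hcount₁ i).trans_eq (by simp [colourCount])) hlV hsum
  refine ⟨a, b, C, fun e he => ?_, hcover.of_subset_or_le_card hC₁C, hC, hcount⟩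
  exact (hst e he).isLink_iff_sym2_eq.2 (hab e (hE.mem_toFinset.2 he)).symm

theorem exists_isForestPacking_of_coverCondition [DecidableEq α] [DecidableEq ι]
    (hV : G.vertexSet.Finite) (hE : G.edgeSet.Finite) {a b : β → α} {C : α → Finset ι}
    (hlink : ∀ e ∈ G.edgeSet, G.IsLink e (a e) (b e))
    (hcover : CoverCondition hV.toFinset hE.toFinset a b h C)
    (hC : ∀ v ∈ hV.toFinset, #(C v) ≤ h) :
    ∃ F : ι → Graph α β, IsForestPacking G F ∧ (∀ v ∈ G.vertexSet, #(graphsAt F v) = h) ∧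
      ∀ i, numComponents (F i) = colourCount hV.toFinset C i := by
  let F : ι → Graph α β := fun i => Graph.noEdge ↑{v ∈ hV.toFinset | i ∈ C v} β
  have hF : IsForestPacking G F := isForestPacking_noEdge fun i v hv => by simp_all
  have hFC : ∀ v ∈ hV.toFinset, graphsAt F v = C v := fun v hv => by
    ext i
    simp [mem_graphsAt, F, hV.mem_toFinset.1 hv]
  obtain ⟨F', hF', hregular, hcomponents⟩ :=
    (hcover.of_subset_or_le_card fun v hv => .inl (hFC v hv).ge).exists_isForestPacking
      (fun e he => hlink e (hE.mem_toFinset.1 he))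
      (fun e he => hV.mem_toFinset.2 (hlink e (hE.mem_toFinset.1 he)).left_mem)
      (fun v hv => (hFC v hv).symm ▸ hC v hv) hF (fun e _ i => by simp [F])
  refine ⟨F', hF', fun v hv => hregular v (hV.mem_toFinset.2 hv), fun i => ?_⟩
  rw [hcomponents, numComponents_noEdge, Set.ncard_coe_finset, colourCount]

theorem IsForestPacking.isRegularForestPacking {k : ℕ} {F : Fin k → Graph α β}
    (hF : IsForestPacking G F) (hregular : ∀ v ∈ G.vertexSet, #(graphsAt F v) = h) :
    IsRegularForestPacking G h k F where
  le := hF.le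
  isForest := hF.isForest
  edgeDisjoint := hF.edgeDisjoint
  regular v hv := by
    rw [← hregular v hv, ← Set.ncard_coe_finset]
    exact congrArg Set.ncard (Set.ext fun i => mem_graphsAt.symm)

end Sufficiency

end ForestPacking


theorem mainTheorem4 {α β : Type*} (G : Graph α β)
    (hV : G.vertexSet.Finite) (hE : G.edgeSet.Finite)
    (h k : ℕ) (hh : 0 < h) (hk : 0 < k) (l : Fin k → ℕ) (hl : ∀ i, 0 < l i) :
    (∃ F : Fin k → Graph α β, ForestPacking.IsRegularForestPacking G h k F ∧
        ∀ i, ForestPacking.numComponents (F i) = l i) ↔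
      (∀ i, l i ≤ G.vertexSet.ncard) ∧
      (∑ i, l i ≤ h * G.vertexSet.ncard) ∧
      (∀ P : Finpartition G.vertexSet,
        h * P.parts.card ≤
          (∑ i, min (l i) P.parts.card) + ForestPacking.crossingNumber G P) := by
  classical
  constructor
  · rintro ⟨F, hF, hFl⟩
    obtain rfl : (fun i => ForestPacking.numComponents (F i)) = l := funext hFl
    have hsub : ∀ i, (F i).vertexSet ⊆ G.vertexSet := fun i => (hF.le i).vertexSet_mono
    have hcard : ∀ i, ForestPacking.numComponents (F i) ≤ (F i).vertexSet.ncard :=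
      fun i => ForestPacking.numComponents_le_ncard (hV.subset (hsub i))
    refine ⟨fun i => (hcard i).trans (Set.ncard_le_ncard (hsub i) hV), ?_,
      hF.mul_card_parts_le hV hE⟩
    exact (Finset.sum_le_sum fun i _ => hcard i).trans_eq (hF.sum_ncard_vertexSet hV)
  · rintro ⟨hlV, hsum, hcond⟩
    have : Nonempty α := ((Set.ncard_pos hV).1 ((hl ⟨0, hk⟩).trans_le (hlV _))).nonempty
    obtain ⟨a, b, C, hlink, hcover, hC, hcount⟩ :=
      ForestPacking.exists_coverCondition hV hE hlV hsum hcond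
    obtain ⟨F, hF, hregular, hcomponents⟩ :=
      ForestPacking.exists_isForestPacking_of_coverCondition hV hE hlink hcover hC
    exact ⟨F, hF.isRegularForestPacking hregular, fun i => (hcomponents i).trans (hcount i)⟩
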